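/- Machines are probabilistic random access machines with logarithmic cost: memory cells hold natural numbers, every memory access is charged the bit lengths of the addresses and values involved, multiplication and division are additionally charged the product of the bit lengths of their arguments, and a machine can flip fair coins. A graph $G$ on the vertices $0,\dots,n-1$ is given by $n$ and its adjacency matrix. Bit strings (the adjacency matrix and, for the verifier, the prover's message) are read by random access. For $k\ge 1$, the $k$-Clique problem is: given a graph $G$, find a clique with $k$ vertices, written as its increasing list of vertices $(v_1,\dots,v_k)$. Let $c(G)$ be the lexicographically first $k$-clique of $G$, if $G$ has a $k$-clique. A $(t_1(n),t_2(n))$ pseudo-deterministic MA proof for $k$-Clique with canonical solution $c$ consists of a (probabilistic) prover machine $P$, which on input $G$ sends one message (a bit string), and a probabilistic verifier machine $V$, which receives $G$ and the message, then flips its coins and returns a list of natural numbers or $\bot$, such that on graphs with $n$ vertices $V$ runs in time at most $t_1(n)$ (for every message and every outcome of the coins), $P$ runs in time at most $t_2(n)$ (for every outcome of its coins), and 1. (canonical completeness) if $G$ has a $k$-clique, then with probability at least $2/3$ the verifier $V$, given the message of $P$, returns $c(G)$; 2. (canonical soundness) if $G$ has a $k$-clique, then for every message, $V$ returns $c(G)$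 or $\bot$ with probability at least $2/3$; 3. (standard soundness) if $G$ has no $k$-clique, then for every message, $V$ returns something other than $\bot$ with probability at most $1/3$. **Theorem.** For every $k\ge 1$, $k$-Clique has a $(\tilde O(n^{\lfloor k/2\rfloor+2}k),\tilde O(n^k))$ pseudo-deterministic MA proof that outputs the lexicographically first $k$-clique. Precisely, there are absolute constants $C$ and $e$ such that for every $k\ge 1$ there is a $(t_1,t_2)$ pseudo-deterministic MA proof for $k$-Clique whose canonical solution is the lexicographically first $k$-clique and such that, for all $n$ large enough (depending on $k$), $$t_1(n)\le C\,n^{\lfloor k/2\rfloor+2}\,k\,(\log n)^{e},\qquad t_2(n)\le C\,n^{k}(\log n)^{e}.$$ -/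

import Mathlib

open MeasureTheory Filter

/-! ## Random access machines with logarithmic cost, coins, and two read-only bit tapes

A machine has memory cells `0, 1, 2, …`, each holding a natural number.  Every access is charged the
bit lengths (`Nat.size`) of the addresses and values involved; multiplication and division are in
addition charged the product of the bit lengths of their arguments. -/

namespace RAM

/-- A memory location: the cell with a fixed address `a`, or the cell whose address is stored in
cell `a`. -/
inductive Loc where
  | dir (a : ℕ)
  | ind (a : ℕ)

/-- An operand: a constant, or the content of a memory location. -/
inductive Operand where
  | const (v : ℕ)
  | cell (l : Loc)

/-- Arithmetic operations on natural numbers; subtraction is truncated, `x / 0 = 0`,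
`x % 0 = x`. -/
inductive BinOp where
  | add
  | sub
  | mul
  | div
  | mod

/-- The read-only tapes: the encoded problem instance, and the message of the other party. -/
inductive Tape where
  | input
  | message

inductive Instr where
  /-- `dst := x` -/
  | move (dst : Loc) (x : Operand)
  /-- `dst := x o y` -/
  | arith (o : BinOp) (dst : Loc) (x y : Operand)
  /-- `dst :=` bit number `x` of tape `t` (`0` beyond its end) -/
  | read (t : Tape) (dst : Loc) (x : Operand)
  /-- `dst :=` a fresh fair random bit -/
  | coin (dst : Loc)
  /-- continue with instruction number `target` if `x < y` -/
  | jumpLT (x y : Operand) (target : ℕ)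
  /-- append `x` to the output -/
  | emit (x : Operand)
  /-- halt, returning the output produced so far -/
  | accept
  /-- halt, returning `⊥` -/
  | reject

/-- A program is a finite list of instructions. -/
abbrev Program := List Instr

/-- What a run depends on besides the program: the size parameter of the instance, the contents of
the two tapes, and the sequence of coin flips. -/
structure Env where
  size : ℕ
  input : List Bool
  message : List Bool
  coins : ℕ → Bool

structure Config where
  /-- number of the next instruction -/
  pc : ℕ
  mem : ℕ → ℕ
  /-- number of coins flipped so far -/
  flips : ℕ
  /-- output produced so far -/
  out : List ℕ
  /-- time spent so far -/
  time : ℕ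

/-- At the start cell `0` holds the size parameter and all other cells hold `0`. -/
def Env.start (E : Env) : Config where
  pc := 0
  mem := Function.update (fun _ => 0) 0 E.size
  flips := 0
  out := []
  time := 0

def Env.tape (E : Env) : Tape → List Bool
  | .input => E.input
  | .message => E.message

def Loc.addr (m : ℕ → ℕ) : Loc → ℕ
  | .dir a => a
  | .ind a => m a

/-- Cost of finding the address of a location. -/
def Loc.cost (m : ℕ → ℕ) : Loc → ℕ
  | .dir a => a.size
  | .ind a => a.size + (m a).size

def Operand.val (m : ℕ → ℕ) : Operand → ℕ
  | .const v => v
  | .cell l => m (l.addr m)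

/-- Cost of fetching an operand. -/
def Operand.cost (m : ℕ → ℕ) : Operand → ℕ
  | .const v => v.size
  | .cell l => l.cost m + (m (l.addr m)).size

def BinOp.eval : BinOp → ℕ → ℕ → ℕ
  | .add, x, y => x + y
  | .sub, x, y => x - y
  | .mul, x, y => x * y
  | .div, x, y => x / y
  | .mod, x, y => x % y

/-- Cost of an arithmetic operation, on top of the cost of fetching its arguments and storing its
result. -/
def BinOp.cost : BinOp → ℕ → ℕ → ℕ
  | .add, _, _ => 0
  | .sub, _, _ => 0
  | .mul, x, y => x.size * y.size
  | .div, x, y => x.size * y.size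
  | .mod, x, y => x.size * y.size

/-- Store `v` at `dst`, charge `extra` plus the cost of storing, and go to the next instruction. -/
def Config.store (c : Config) (dst : Loc) (v extra : ℕ) : Config :=
  { c with
    pc := c.pc + 1
    mem := Function.update c.mem (dst.addr c.mem) v
    time := c.time + (1 + dst.cost c.mem + v.size + extra) }

/-- One step of the program `p`; a halted configuration stays as it is. -/
def step (p : Program) (E : Env) (c : Config) : Config :=
  match p[c.pc]? with
  | none => c
  | some .accept => c
  | some .reject => c
  | some (.move dst x) => c.store dst (x.val c.mem) (x.cost c.mem)
  | some (.arith o dst x y) =>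
      c.store dst (o.eval (x.val c.mem) (y.val c.mem))
        (x.cost c.mem + y.cost c.mem + o.cost (x.val c.mem) (y.val c.mem))
  | some (.read t dst x) =>
      c.store dst ((E.tape t).getD (x.val c.mem) false).toNat (x.cost c.mem)
  | some (.coin dst) =>
      { c.store dst (E.coins c.flips).toNat 0 with flips := c.flips + 1 }
  | some (.jumpLT x y target) =>
      { c with
        pc := if x.val c.mem < y.val c.mem then target else c.pc + 1
        time := c.time + (1 + x.cost c.mem + y.cost c.mem) }
  | some (.emit x) =>
      { c with
        pc := c.pc + 1
        out := c.out ++ [x.val c.mem]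
        time := c.time + (1 + x.cost c.mem) }

/-- The configuration is halted: the next instruction is `accept` or `reject`, or does not exist
(which counts as `reject`). -/
def Config.Halted (p : Program) (c : Config) : Prop :=
  p[c.pc]? = none ∨ p[c.pc]? = some .accept ∨ p[c.pc]? = some .reject

open Classical in
/-- The result of a halted configuration: the output if the machine accepts, `none` (that is, `⊥`)
otherwise. -/
noncomputable def Config.result (p : Program) (c : Config) : Option (List ℕ) :=
  if p[c.pc]? = some .accept then some c.out else none

/-- In the environment `E` the program halts with result `r` in time at most `T`. -/
def HaltsIn (p : Program) (E : Env) (T : ℕ) (r : Option (List ℕ)) : Prop :=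
  ∃ t : ℕ, ((step p E)^[t] E.start).Halted p ∧ ((step p E)^[t] E.start).time ≤ T ∧
    ((step p E)^[t] E.start).result p = r

/-- In the environment `E` the program halts with result `r`. -/
def Returns (p : Program) (E : Env) (r : Option (List ℕ)) : Prop :=
  ∃ T : ℕ, HaltsIn p E T r

/-- The law of an infinite sequence of independent fair coins. -/
noncomputable def fairCoins : Measure (ℕ → Bool) :=
  Measure.infinitePi fun _ : ℕ => (PMF.uniformOfFintype Bool).toMeasure

end RAM

/-! ## Pseudo-deterministic Merlin–Arthur proofs for search problems -/

/-- A search problem: a type of instances, each with a size parameter and an encoding by bits, and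
the relation between instances and solutions (which are finite sequences of natural numbers). -/
structure SearchProblem where
  Inst : Type
  size : Inst → ℕ
  encode : Inst → List Bool
  Sol : Inst → List ℕ → Prop

namespace SearchProblem

/-- The instances that have a solution. -/
def solvable (R : SearchProblem) : Set R.Inst := {x | ∃ y, R.Sol x y}

/-- The prover sees the instance, and no message. -/
def proverEnv (R : SearchProblem) (x : R.Inst) (ρ : ℕ → Bool) : RAM.Env :=
  ⟨R.size x, R.encode x, [], ρ⟩

/-- The verifier sees the instance and the prover's message `w`. -/
def verifierEnv (R : SearchProblem) (x : R.Inst) (w : List Bool) (r : ℕ → Bool) : RAM.Env :=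
  ⟨R.size x, R.encode x, w, r⟩

/-- With coins `ρ` the prover `P` sends the bit string `w`, a `1` for every non-zero number in its
output and a `0` for every zero. -/
def Sends (R : SearchProblem) (P : RAM.Program) (x : R.Inst) (ρ : ℕ → Bool) (w : List Bool) :
    Prop :=
  ∃ out : List ℕ, RAM.Returns P (R.proverEnv x ρ) (some out) ∧ w = out.map fun v => decide (v ≠ 0)

/-- `(V, P)` is a `(t₁, t₂)` pseudo-deterministic MA proof for `R` with canonical solutions `c`:
the prover sends a single message, then the verifier flips its coins and returns a solution or `⊥`.
A dishonest prover may send any message.  The time bounds hold for all instances, messages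
and coins. -/
structure IsPseudoDetMA (R : SearchProblem) (c : R.Inst → List ℕ) (V P : RAM.Program)
    (t₁ t₂ : ℕ → ℕ) : Prop where
  canonical : ∀ x ∈ R.solvable, R.Sol x (c x)
  completeness : ∀ x ∈ R.solvable,
    2 / 3 ≤ (RAM.fairCoins.prod RAM.fairCoins) {ρr : (ℕ → Bool) × (ℕ → Bool) |
      ∃ w, R.Sends P x ρr.1 w ∧ RAM.Returns V (R.verifierEnv x w ρr.2) (some (c x))}
  canonical_soundness : ∀ x ∈ R.solvable, ∀ w : List Bool,
    2 / 3 ≤ RAM.fairCoins {r : ℕ → Bool |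
      RAM.Returns V (R.verifierEnv x w r) (some (c x)) ∨ RAM.Returns V (R.verifierEnv x w r) none}
  standard_soundness : ∀ x ∉ R.solvable, ∀ w : List Bool,
    RAM.fairCoins {r : ℕ → Bool | ¬ RAM.Returns V (R.verifierEnv x w r) none} ≤ 1 / 3
  verifier_time : ∀ (x : R.Inst) (w : List Bool) (r : ℕ → Bool),
    ∃ a, RAM.HaltsIn V (R.verifierEnv x w r) (t₁ (R.size x)) a
  prover_time : ∀ (x : R.Inst) (ρ : ℕ → Bool),
    ∃ a, RAM.HaltsIn P (R.proverEnv x ρ) (t₂ (R.size x)) a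

/-- `y` is the lexicographically first solution of the instance `x`. -/
def IsLexFirst (R : SearchProblem) (x : R.Inst) (y : List ℕ) : Prop :=
  R.Sol x y ∧ ∀ y', R.Sol x y' → y = y' ∨ List.Lex (· < ·) y y'

end SearchProblem

open Classical in
/-- The `k`-Clique problem.  An instance is a graph with vertices `0, …, n - 1`, given by `n` and
its adjacency matrix, row by row.  A solution is the increasing list of the vertices of a
`k`-clique. -/
noncomputable def kClique (k : ℕ) : SearchProblem where
  Inst := Σ n : ℕ, SimpleGraph (Fin n)
  size G := G.1
  encode G := List.ofFn fun t : Fin (G.1 * G.1) => decide (G.2.Adj t.divNat t.modNat)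
  Sol G y := ∃ s : Finset (Fin G.1),
    G.2.IsNClique k s ∧ y = (s.sort (· ≤ ·)).map fun v => (v : ℕ)

/-! Put `b = k / 2` and `a = k - b`. A `k`-tuple of vertices is coded by the number with these
digits in base `n`, the most significant first, so that lexicographic order becomes the order of
numbers (`tup_lex`). A code splits as `X * n ^ b + T` into a head `X` of `a` vertices and a tail `T`
of `b` vertices. It codes an increasing clique iff `X` does, `T` does, and every vertex of `X` is
adjacent to and smaller than every vertex of `T` (`chain_split`).

The prover sends the head `x` of the first clique and, for every `T`, the number of clique heads `X
< x` that are joined to all of `T` (`count`). The verifier finds the first tail completing `x` by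
itself. It remains to exclude cliques with a head below `x`: the table entry must vanish at every
`T` that is a clique, and the table must be correct. For the latter, random numbers `r j v` are
drawn and `∑ T, table T * ∏ j, r j (T j)` is compared with the same form in the true counts. By the
distributive law (`sum_count`) the true form is `∑ X < x, [X clique] * ∏ j, ∑ v, [v joined to X] * r
j v`, which takes about `n ^ (a + 1) ≤ n ^ (b + 2)` operations instead of `n ^ k`. A wrong table
gives a nonzero polynomial of degree at most `b`, and by Schwartz–Zippel it vanishes at numbers of
`k + 2` random bits with probability at most `b / 2 ^ (k + 2) ≤ 1 / 3` (`fairCoins_form_le`).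

The honest message is always accepted, and an accepted answer is always a clique. If it is not the
first one, the table has a zero at the tail of the first clique although the true count there is
positive, so the random test catches it (`fairCoins_accepts_le`).

For the running times, programs are assembled from expressions whose value and number of
instructions are tracked by `Has`. All numbers have `O(log n)` bits for fixed `k`, so an instruction
costs at most a power of `log n`. One further factor `log n` absorbs the constants depending on `k`,
since `n` may be large depending on `k`. -/

namespace RAM

/-! ### Structured code and its compilation to jumps -/

/-- Structured programs: instructions, sequences, conditionals and while loops. -/
inductive Code where
  | instr (i : Instr)
  | seq (s t : Code)
  | ite (x y : Operand) (s t : Code)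
  | loop (x y : Operand) (s : Code)

def Code.len : Code → ℕ
  | .instr _ => 1
  | .seq s t => s.len + t.len
  | .ite _ _ s t => s.len + t.len + 2
  | .loop _ _ s => s.len + 3

/-- An unconditional jump. -/
def goto (target : ℕ) : Instr := .jumpLT (.const 0) (.const 1) target

/-- The instructions of a structured program that starts at instruction number `o`. -/
def Code.compile : Code → ℕ → Program
  | .instr i, _ => [i]
  | .seq s t, o => s.compile o ++ t.compile (o + s.len)
  | .ite x y s t, o =>
      .jumpLT x y (o + t.len + 2) ::
        (t.compile (o + 1) ++ goto (o + t.len + 2 + s.len) :: s.compile (o + t.len + 2))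
  | .loop x y s, o =>
      .jumpLT x y (o + 2) :: goto (o + s.len + 3) :: (s.compile (o + 2) ++ [goto o])

theorem Code.length_compile (s : Code) (o : ℕ) : (s.compile o).length = s.len := by
  induction s generalizing o with
  | instr => rfl
  | seq s t hs ht => simp [compile, len, hs, ht]
  | ite x y s t hs ht => simp [compile, len, hs, ht]; omega
  | loop x y s hs => simp [compile, len, hs]

/-- The list `l` occurs in `p` from position `o` on. -/
def Located (p : Program) : List Instr → ℕ → Prop
  | [], _ => True
  | i :: l, o => p[o]? = some i ∧ Located p l (o + 1)

theorem located_append {p : Program} {l l' : List Instr} {o : ℕ} :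
    Located p (l ++ l') o ↔ Located p l o ∧ Located p l' (o + l.length) := by
  induction l generalizing o with
  | nil => simp [Located]
  | cons i l ih =>
    simp only [List.cons_append, Located, ih, List.length_cons, and_assoc]
    rw [show o + 1 + l.length = o + (l.length + 1) by omega]

theorem located_self (pre l : List Instr) : Located (pre ++ l) l pre.length := by
  induction l generalizing pre with
  | nil => trivial
  | cons i l ih =>
    refine ⟨by simp, ?_⟩
    have := ih (pre ++ [i])
    simpa using this

/-- The part of a configuration that structured code manipulates. -/
structure St where
  mem : ℕ → ℕ
  flips : ℕ
  out : List ℕ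

def St.toConfig (σ : St) (pc time : ℕ) : Config := ⟨pc, σ.mem, σ.flips, σ.out, time⟩

/-! ### Execution of structured code and its cost. -/

def Reaches (p : Program) (E : Env) (c c' : Config) : Prop := ∃ t, (step p E)^[t] c = c'

theorem Reaches.trans {p : Program} {E : Env} {c c' c'' : Config} (h : Reaches p E c c')
    (h' : Reaches p E c' c'') : Reaches p E c c'' := by
  obtain ⟨t, rfl⟩ := h
  obtain ⟨t', rfl⟩ := h'
  exact ⟨t' + t, Function.iterate_add_apply _ _ _ _⟩

theorem Reaches.single {p : Program} {E : Env} {c c' : Config} (h : step p E c = c') :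
    Reaches p E c c' := ⟨1, h⟩

/-- An upper bound for the cost of an instruction on numbers and addresses of at most `L` bits. -/
def unit (L : ℕ) : ℕ := L * L + 6 * L + 1

/-- From the state `σ` the code `s` leads to the state `σ'`, at a cost of at most `N` units. -/
def Runs (E : Env) (L : ℕ) (s : Code) (σ σ' : St) (N : ℕ) : Prop :=
  ∀ (p : Program) (o τ : ℕ), Located p (s.compile o) o →
    ∃ τ' ≤ τ + N * unit L, Reaches p E (σ.toConfig o τ) (σ'.toConfig (o + s.len) τ')

variable {E : Env} {L : ℕ}

theorem Runs.mono {s : Code} {σ σ' : St} {N N' : ℕ} (h : Runs E L s σ σ' N) (hN : N ≤ N') :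
    Runs E L s σ σ' N' := fun p o τ hp => by
  obtain ⟨τ', h1, h2⟩ := h p o τ hp
  exact ⟨τ', h1.trans (by gcongr), h2⟩

/-- `Runs` quantifies over the surrounding program and the starting position, so fragments compose
although their jump targets are absolute. -/
theorem Runs.seq {s t : Code} {σ σ' σ'' : St} {N N' : ℕ} (h : Runs E L s σ σ' N)
    (h' : Runs E L t σ' σ'' N') : Runs E L (.seq s t) σ σ'' (N + N') := fun p o τ hp => by
  rw [Code.compile, located_append, Code.length_compile] at hp
  obtain ⟨τ₁, h1, h2⟩ := h p o τ hp.1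
  obtain ⟨τ₂, h3, h4⟩ := h' p _ τ₁ hp.2
  refine ⟨τ₂, by linarith [add_mul N N' (unit L)], h2.trans ?_⟩
  rwa [Code.len, ← add_assoc]

theorem runs_instr {i : Instr} {σ σ' : St} {c : ℕ} (hc : c ≤ unit L)
    (h : ∀ (p : Program) (o τ : ℕ), p[o]? = some i →
      step p E (σ.toConfig o τ) = σ'.toConfig (o + 1) (τ + c)) :
    Runs E L (.instr i) σ σ' 1 := fun p o τ hp =>
  ⟨τ + c, by omega, .single (h p o τ hp.1)⟩

theorem step_goto {p : Program} {o τ target : ℕ} (σ : St) (h : p[o]? = some (goto target)) :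
    step p E (σ.toConfig o τ) = σ.toConfig target (τ + 2) := by
  simp [step, St.toConfig, h, goto, Operand.val, Operand.cost]

theorem step_jumpLT {p : Program} {o τ target : ℕ} {x y : Operand} (σ : St)
    (h : p[o]? = some (.jumpLT x y target)) :
    step p E (σ.toConfig o τ) =
      σ.toConfig (if x.val σ.mem < y.val σ.mem then target else o + 1)
        (τ + (1 + x.cost σ.mem + y.cost σ.mem)) := by
  simp only [step, St.toConfig, h]
  rfl

theorem two_le_unit (hL : 1 ≤ L) : 2 ≤ unit L := by unfold unit; nlinarith

/-- The two extra units pay for the comparison and for the jump over `s`. The latter occurs only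
after `t`, which is placed first. -/
theorem Runs.ite {x y : Operand} {s t : Code} {σ σ' : St} {N : ℕ} (hL : 1 ≤ L)
    (hc : 1 + x.cost σ.mem + y.cost σ.mem ≤ unit L)
    (h : if x.val σ.mem < y.val σ.mem then Runs E L s σ σ' N else Runs E L t σ σ' N) :
    Runs E L (.ite x y s t) σ σ' (N + 2) := fun p o τ hp => by
  simp only [Code.compile, Located, located_append, Code.length_compile] at hp
  obtain ⟨hj, ht, hg, hs⟩ := hp
  have h1 := step_jumpLT (E := E) (τ := τ) σ hj
  have := two_le_unit hL
  split_ifs at h with hlt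
  · rw [if_pos hlt] at h1
    obtain ⟨τ', h2, h3⟩ := h p (o + t.len + 2) (τ + (1 + x.cost σ.mem + y.cost σ.mem)) (by
      rwa [show o + t.len + 2 = o + 1 + t.len + 1 by omega] at *)
    refine ⟨τ', by nlinarith, (Reaches.single h1).trans ?_⟩
    rwa [Code.len, show o + (s.len + t.len + 2) = o + t.len + 2 + s.len by omega]
  · rw [if_neg hlt] at h1
    obtain ⟨τ', h2, h3⟩ := h p (o + 1) (τ + (1 + x.cost σ.mem + y.cost σ.mem)) ht
    refine ⟨τ' + 2, by nlinarith, (Reaches.single h1).trans (h3.trans (.single ?_))⟩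
    rw [step_goto σ' hg, Code.len]
    congr 1; omega

/-- One round is peeled off the front; the two extra units are its test and the jump back. -/
theorem Runs.loop_true {x y : Operand} {s : Code} {σ σ' σ'' : St} {N N' : ℕ} (hL : 1 ≤ L)
    (hc : 1 + x.cost σ.mem + y.cost σ.mem ≤ unit L) (hlt : x.val σ.mem < y.val σ.mem)
    (h : Runs E L s σ σ' N) (h' : Runs E L (.loop x y s) σ' σ'' N') :
    Runs E L (.loop x y s) σ σ'' (N + N' + 2) := fun p o τ hp => by
  have hp' := hp
  simp only [Code.compile, Located, located_append, Code.length_compile] at hp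
  obtain ⟨hj, -, hs, hg, -⟩ := hp
  have h1 := step_jumpLT (E := E) (τ := τ) σ hj
  rw [if_pos hlt] at h1
  have := two_le_unit hL
  obtain ⟨τ₁, h2, h3⟩ := h p (o + 2) (τ + (1 + x.cost σ.mem + y.cost σ.mem)) hs
  obtain ⟨τ₂, h4, h5⟩ := h' p o (τ₁ + 2) hp'
  refine ⟨τ₂, by nlinarith, (Reaches.single h1).trans (h3.trans ((Reaches.single ?_).trans h5))⟩
  rw [step_goto σ' hg]

theorem Runs.loop_false {x y : Operand} {s : Code} {σ : St} (hL : 1 ≤ L)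
    (hc : 1 + x.cost σ.mem + y.cost σ.mem ≤ unit L) (hlt : ¬ x.val σ.mem < y.val σ.mem) :
    Runs E L (.loop x y s) σ σ 2 := fun p o τ hp => by
  simp only [Code.compile, Located, located_append, Code.length_compile] at hp
  obtain ⟨hj, hg, -⟩ := hp
  have h1 := step_jumpLT (E := E) (τ := τ) σ hj
  rw [if_neg hlt] at h1
  have := two_le_unit hL
  refine ⟨τ + (1 + x.cost σ.mem + y.cost σ.mem) + 2, by omega,
    (Reaches.single h1).trans (.single ?_)⟩
  rw [step_goto σ hg]
  rfl

/-! ### Registers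

Register `r` is memory cell `2 * r`; the cells with odd addresses hold a table. -/

def R (r : ℕ) : Loc := .dir (2 * r)

def St.set (σ : St) (r v : ℕ) : St := { σ with mem := Function.update σ.mem (2 * r) v }

theorem cost_reg_le {m : ℕ → ℕ} {r : ℕ} (hr : 2 * r < 2 ^ L) (hv : m (2 * r) < 2 ^ L) :
    (Operand.cell (R r)).cost m ≤ 2 * L := by
  have h1 := Nat.size_le.2 hr
  have h2 := Nat.size_le.2 hv
  simp only [Operand.cost, R, Loc.cost, Loc.addr]
  omega

/-! ### Costs of single instructions on registers. -/

theorem runs_move {r v : ℕ} {x : Operand} {σ : St} (hr : 2 * r < 2 ^ L)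
    (hv : x.val σ.mem = v) (hvL : v < 2 ^ L) (hx : x.cost σ.mem ≤ 3 * L) :
    Runs E L (.instr (.move (R r) x)) σ (σ.set r v) 1 := by
  refine runs_instr (c := 1 + (R r).cost σ.mem + v.size + x.cost σ.mem) ?_ ?_
  · have h1 := Nat.size_le.2 hr
    have h2 := Nat.size_le.2 hvL
    simp only [R, Loc.cost, unit]
    nlinarith
  · intro p o τ h
    simp [step, St.toConfig, h, Config.store, St.set, R, Loc.addr, hv, add_assoc]

/-- This instruction dictates the form of `unit`: `1 + 2 * L` for storing, `2 * L` for each operand,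
and `L * L` for a multiplication or division. -/
theorem runs_arith {o : BinOp} {r v w : ℕ} {x y : Operand} {σ : St} (hr : 2 * r < 2 ^ L)
    (hv : x.val σ.mem = v) (hw : y.val σ.mem = w) (hvL : v < 2 ^ L) (hwL : w < 2 ^ L)
    (hoL : o.eval v w < 2 ^ L) (hx : x.cost σ.mem ≤ 2 * L) (hy : y.cost σ.mem ≤ 2 * L) :
    Runs E L (.instr (.arith o (R r) x y)) σ (σ.set r (o.eval v w)) 1 := by
  refine runs_instr (c := 1 + (R r).cost σ.mem + (o.eval v w).size +
    (x.cost σ.mem + y.cost σ.mem + o.cost v w)) ?_ ?_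
  · have h1 := Nat.size_le.2 hr
    have h2 := Nat.size_le.2 hoL
    have h3 : o.cost v w ≤ L * L := by
      have := Nat.mul_le_mul (Nat.size_le.2 hvL) (Nat.size_le.2 hwL)
      cases o <;> simp only [BinOp.cost] <;> omega
    simp only [R, Loc.cost, unit]
    omega
  · intro p q τ h
    simp [step, St.toConfig, h, Config.store, St.set, R, Loc.addr, hv, hw, add_assoc]

theorem size_toNat_le (b : Bool) : b.toNat.size ≤ 1 := by
  cases b <;> simp

theorem runs_read {t : Tape} {r s v : ℕ} {σ : St} (hr : 2 * r < 2 ^ L) (hs : 2 * s < 2 ^ L)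
    (hv : σ.mem (2 * s) = v) (hvL : v < 2 ^ L) (hL : 1 ≤ L) :
    Runs E L (.instr (.read t (R r) (.cell (R s)))) σ
      (σ.set r ((E.tape t).getD v false).toNat) 1 := by
  have hx := cost_reg_le hs (hv ▸ hvL)
  refine runs_instr (c := 1 + (R r).cost σ.mem + (((E.tape t).getD v false).toNat).size +
    (Operand.cell (R s)).cost σ.mem) ?_ ?_
  · have h1 := Nat.size_le.2 hr
    have h2 := size_toNat_le ((E.tape t).getD v false)
    simp only [R, Loc.cost, unit] at *
    nlinarith
  · intro p o τ h
    simp [step, St.toConfig, h, Config.store, St.set, R, Loc.addr, Operand.val, hv, add_assoc]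

theorem runs_emit {s v : ℕ} {σ : St} (hs : 2 * s < 2 ^ L) (hv : σ.mem (2 * s) = v)
    (hvL : v < 2 ^ L) :
    Runs E L (.instr (.emit (.cell (R s)))) σ { σ with out := σ.out ++ [v] } 1 := by
  have hx := cost_reg_le hs (hv ▸ hvL)
  refine runs_instr (c := 1 + (Operand.cell (R s)).cost σ.mem) ?_ ?_
  · simp only [unit]
    nlinarith
  · intro p o τ h
    simp [step, St.toConfig, h, R, Loc.addr, Operand.val, hv]

theorem runs_coin {s a : ℕ} {σ : St} (hs : 2 * s < 2 ^ L) (ha : σ.mem (2 * s) = a)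
    (haL : a < 2 ^ L) (hL : 1 ≤ L) :
    Runs E L (.instr (.coin (.ind (2 * s)))) σ
      ⟨Function.update σ.mem a (E.coins σ.flips).toNat, σ.flips + 1, σ.out⟩ 1 := by
  refine runs_instr (c := 1 + (Loc.ind (2 * s)).cost σ.mem + (E.coins σ.flips).toNat.size + 0) ?_ ?_
  · have h1 := Nat.size_le.2 hs
    have h2 := Nat.size_le.2 haL
    have h3 := size_toNat_le (E.coins σ.flips)
    simp only [Loc.cost, unit, ha]
    nlinarith
  · intro p o τ h
    simp [step, St.toConfig, h, Config.store, Loc.addr, ha]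

end RAM

namespace RAM

variable {E : Env} {L : ℕ}

/-! ### Counting loops -/

/-- Increment register `c`. -/
def inc (c : ℕ) : Code := .instr (.arith .add (R c) (.cell (R c)) (.const 1))

theorem runs_inc {c i : ℕ} {σ : St} (hL : 1 ≤ L) (hc : 2 * c < 2 ^ L) (hi : σ.mem (2 * c) = i)
    (hiL : i + 1 < 2 ^ L) : Runs E L (inc c) σ (σ.set c (i + 1)) 1 :=
  runs_arith (o := .add) hc hi rfl (by omega) (Nat.one_lt_two_pow (by omega)) hiL
    (cost_reg_le hc (by omega)) (by simp [Operand.cost]; omega)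

/-- While register `c` is less than register `b`, perform `s` and increment register `c`. -/
def countLoop (c b : ℕ) (s : Code) : Code :=
  .loop (.cell (R c)) (.cell (R b)) (.seq s (inc c))

/-- Beyond the body, a round pays for the increment, the test and the jump back; the final `2` is
the failing test and the exit. -/
theorem runs_countLoop {c b nv Nb : ℕ} {s : Code} (Inv : ℕ → St → Prop) (hL : 1 ≤ L)
    (hc : 2 * c < 2 ^ L) (hb : 2 * b < 2 ^ L) (hnv : nv < 2 ^ L)
    (hinv : ∀ i σ, Inv i σ → σ.mem (2 * c) = i ∧ σ.mem (2 * b) = nv)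
    (hstep : ∀ i < nv, ∀ σ, Inv i σ → ∃ σ', Runs E L s σ σ' Nb ∧ σ'.mem (2 * c) = i ∧
      Inv (i + 1) (σ'.set c (i + 1))) (σ : St) (h : Inv 0 σ) :
    ∃ σ', Runs E L (countLoop c b s) σ σ' (nv * (Nb + 3) + 2) ∧ Inv nv σ' := by
  -- Induction on the number `j` of remaining rounds, because loops are unfolded from the front.
  suffices H : ∀ j ≤ nv, ∀ σ, Inv (nv - j) σ →
      ∃ σ', Runs E L (countLoop c b s) σ σ' (j * (Nb + 3) + 2) ∧ Inv nv σ' from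
    H nv le_rfl σ (by simpa using h)
  have hcost : ∀ i ≤ nv, ∀ σ, Inv i σ →
      1 + (Operand.cell (R c)).cost σ.mem + (Operand.cell (R b)).cost σ.mem ≤ unit L := by
    intro i hi σ hσ
    obtain ⟨h1, h2⟩ := hinv i σ hσ
    have h3 := cost_reg_le (m := σ.mem) hc (by omega)
    have h4 := cost_reg_le (m := σ.mem) hb (by omega)
    unfold unit
    nlinarith
  intro j
  induction j with
  | zero =>
    intro _ σ hσ
    obtain ⟨h1, h2⟩ := hinv _ σ hσ
    refine ⟨σ, (Runs.loop_false hL (hcost _ (by omega) σ hσ) ?_).mono (by omega), hσ⟩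
    simp only [Operand.val, R, Loc.addr, h1, h2]
    omega
  | succ j ih =>
    intro hj σ hσ
    obtain ⟨h1, h2⟩ := hinv _ σ hσ
    obtain ⟨σ₁, hr, hc1, hI⟩ := hstep _ (by omega) σ hσ
    obtain ⟨σ₂, hr2, hI2⟩ := ih (by omega) _ (by rwa [show nv - (j + 1) + 1 = nv - j by omega] at hI)
    rw [show nv - j = nv - (j + 1) + 1 by omega] at hr2
    refine ⟨σ₂, (Runs.loop_true hL (hcost _ (by omega) σ hσ) ?_
      (hr.seq (runs_inc hL hc hc1 (by omega))) hr2).mono (by linarith), hI2⟩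
    simp only [Operand.val, R, Loc.addr, h1, h2]
    omega

/-! ### Expressions -/

theorem runs_move_reg {d r v f : ℕ} {m : ℕ → ℕ} {l : List ℕ} (hd : 2 * d < 2 ^ L)
    (hr : 2 * r < 2 ^ L) (hv : m (2 * r) = v) (hvL : v < 2 ^ L) :
    Runs E L (.instr (.move (R d) (.cell (R r)))) ⟨m, f, l⟩
      ⟨Function.update m (2 * d) v, f, l⟩ 1 :=
  runs_move (σ := ⟨m, f, l⟩) hd hv hvL ((cost_reg_le (L := L) hr (hv.trans_lt hvL)).trans (by omega))

theorem runs_arith_reg {o : BinOp} {d r s v w f : ℕ} {m : ℕ → ℕ} {l : List ℕ}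
    (hd : 2 * d < 2 ^ L) (hr : 2 * r < 2 ^ L) (hs : 2 * s < 2 ^ L) (hv : m (2 * r) = v)
    (hw : m (2 * s) = w) (hvL : v < 2 ^ L) (hwL : w < 2 ^ L) (ho : o.eval v w < 2 ^ L) :
    Runs E L (.instr (.arith o (R d) (.cell (R r)) (.cell (R s)))) ⟨m, f, l⟩
      ⟨Function.update m (2 * d) (o.eval v w), f, l⟩ 1 :=
  runs_arith (σ := ⟨m, f, l⟩) hd hv hw hvL hwL ho (cost_reg_le (L := L) hr (hv.trans_lt hvL))
    (cost_reg_le (L := L) hs (hw.trans_lt hwL))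

/-- The memories `m` and `m'` agree on the table and on the registers below `D`. -/
def Agree (D : ℕ) (m m' : ℕ → ℕ) : Prop := ∀ c, c % 2 = 1 ∨ c < 2 * D → m' c = m c

theorem Agree.refl (D : ℕ) (m : ℕ → ℕ) : Agree D m m := fun _ _ => rfl

theorem Agree.trans {D D' : ℕ} {m m' m'' : ℕ → ℕ} (h : Agree D m m') (h' : Agree D' m' m'')
    (hD : D ≤ D') : Agree D m m'' := fun c hc => by
  rw [h' c (by omega), h c hc]

theorem Agree.reg {D r : ℕ} {m m' : ℕ → ℕ} (h : Agree D m m') (hr : r < D) :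
    m' (2 * r) = m (2 * r) := h _ (by omega)

theorem agree_update {D r v : ℕ} {m : ℕ → ℕ} (hr : D ≤ r) :
    Agree D m (Function.update m (2 * r) v) := fun c hc => by
  rw [Function.update_of_ne (by omega)]

/-- What is known about the memory: the table and the registers below `D` are as in `m`. -/
structure Ctx where
  D : ℕ
  m : ℕ → ℕ

/-- A larger context knows more, so a memory that matches it also matches the smaller one. This
makes `Has` monotone (`Has.lift`). -/
instance : LE Ctx := ⟨fun Γ Γ' => Γ.D ≤ Γ'.D ∧ Agree Γ.D Γ.m Γ'.m⟩

theorem Ctx.le_trans {Γ Γ' Γ'' : Ctx} (h : Γ ≤ Γ') (h' : Γ' ≤ Γ'') : Γ ≤ Γ'' :=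
  ⟨h.1.trans h'.1, h.2.trans h'.2 h.1⟩

/-- An expression: given a register `d`, code that computes the value of the expression into
register `d`, and does not change the table or the registers below `d`. -/
abbrev Ex := ℕ → Code

/-- In the context `Γ` the expression `x` evaluates to `v`, at a cost of at most `N` units, using at
most `h` registers. -/
def Has (E : Env) (L : ℕ) (Γ : Ctx) (x : Ex) (v N h : ℕ) : Prop :=
  v < 2 ^ L ∧ ∀ (d : ℕ) (m : ℕ → ℕ) (f : ℕ) (o : List ℕ), Γ.D ≤ d →
    2 * (d + h) < 2 ^ L → Agree Γ.D Γ.m m →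
    ∃ m', Runs E L (x d) ⟨m, f, o⟩ ⟨m', f, o⟩ N ∧ m' (2 * d) = v ∧ Agree d m m'

variable {Γ Γ' : Ctx} {x y : Ex} {v w N N' h h' : ℕ}

theorem Has.lift (hx : Has E L Γ x v N h) (hΓ : Γ ≤ Γ') : Has E L Γ' x v N h :=
  ⟨hx.1, fun d m f l hd hh hσ => hx.2 d m f l (hΓ.1.trans hd) hh (hΓ.2.trans hσ hΓ.1)⟩

theorem Has.mono (hx : Has E L Γ x v N h) (hN : N ≤ N') (hh : h ≤ h') : Has E L Γ x v N' h' :=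
  ⟨hx.1, fun d m f l hd hh' hσ => by
    obtain ⟨m', h1, h2⟩ := hx.2 d m f l hd (by omega) hσ
    exact ⟨m', h1.mono hN, h2⟩⟩

theorem one_le_of_lt {d : ℕ} (hd : 2 * d < 2 ^ L) (h0 : 0 < d) : 1 ≤ L := by
  rcases Nat.eq_zero_or_pos L with rfl | h
  · omega
  · exact h

def constE (v : ℕ) : Ex := fun d => .instr (.move (R d) (.const v))

theorem Has.const (hv : v < 2 ^ L) : Has E L Γ (constE v) v 1 1 := by
  refine ⟨hv, fun d m f l hd hh hσ => ⟨_, runs_move (by omega) rfl hv ?_, ?_, ?_⟩⟩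
  · have := Nat.size_le.2 hv
    simp only [Operand.cost]
    omega
  · simp [Operand.val]
  · exact agree_update le_rfl

def regE (r : ℕ) : Ex := fun d => .instr (.move (R d) (.cell (R r)))

theorem Has.reg {r : ℕ} (hr : r < Γ.D) (hv : Γ.m (2 * r) = v) (hvL : v < 2 ^ L) :
    Has E L Γ (regE r) v 1 1 := by
  refine ⟨hvL, fun d m f l hd hh hσ => ?_⟩
  have h1 := hσ.reg hr
  refine ⟨_, runs_move_reg (by omega) (by omega) (h1.trans hv) hvL, ?_, agree_update le_rfl⟩
  simp

/-- The content of the memory cell with address `x`. -/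
def cellE (x : Ex) : Ex := fun d => .seq (x d) (.instr (.move (R d) (.cell (.ind (2 * d)))))

/-- An odd address lies in the table, which evaluating expressions never changes; hence its content
is still the one recorded in `Γ`. -/
theorem Has.cell (hx : Has E L Γ x v N h) (hv : v % 2 = 1) (hw : Γ.m v = w) (hwL : w < 2 ^ L) :
    Has E L Γ (cellE x) w (N + 1) (h + 1) := by
  refine ⟨hwL, fun d m f l hd hh hσ => ?_⟩
  obtain ⟨m', h1, h2, h3⟩ := hx.2 d m f l hd (by omega) hσ
  have h4 : m' v = w := by rw [h3 v (.inl hv), hσ v (.inl hv), hw]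
  refine ⟨_, h1.seq (runs_move (v := w) (by omega) ?_ hwL ?_), ?_, h3.trans (agree_update le_rfl) le_rfl⟩
  · simp [Operand.val, Loc.addr, h2, h4]
  · have h5 := Nat.size_le.2 hwL
    have h6 := Nat.size_le.2 hx.1
    have h7 := Nat.size_le.2 (show 2 * d < 2 ^ L by omega)
    simp only [Operand.cost, Loc.cost, Loc.addr, h2, h4]
    omega
  · simp

/-- Bit number `x` of the tape `t`. -/
def bitE (t : Tape) (x : Ex) : Ex := fun d => .seq (x d) (.instr (.read t (R d) (.cell (R d))))

theorem Has.bit {t : Tape} (hx : Has E L Γ x v N h) (hL : 1 ≤ L) :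
    Has E L Γ (bitE t x) ((E.tape t).getD v false).toNat (N + 1) (h + 1) := by
  refine ⟨?_, fun d m f l hd hh hσ => ?_⟩
  · have := Bool.toNat_lt ((E.tape t).getD v false)
    have := Nat.pow_le_pow_right two_pos hL
    omega
  obtain ⟨m', h1, h2, h3⟩ := hx.2 d m f l hd (by omega) hσ
  refine ⟨_, h1.seq (runs_read (by omega) (by omega) h2 hx.1 hL), ?_,
    h3.trans (agree_update le_rfl) le_rfl⟩
  simp

def binE (o : BinOp) (x y : Ex) : Ex := fun d =>
  .seq (x d) (.seq (y (d + 1)) (.instr (.arith o (R d) (.cell (R d)) (.cell (R (d + 1))))))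

/-- The registers serve as a stack: evaluating `y` into register `d + 1` does not touch register
`d`, where the value of `x` waits. -/
theorem Has.bin {o : BinOp} (hx : Has E L Γ x v N h) (hy : Has E L Γ y w N' h')
    (ho : o.eval v w < 2 ^ L) :
    Has E L Γ (binE o x y) (o.eval v w) (N + N' + 1) (h + h' + 2) := by
  refine ⟨ho, fun d m f l hd hh hσ => ?_⟩
  obtain ⟨m₁, h1, h2, h3⟩ := hx.2 d m f l hd (by omega) hσ
  obtain ⟨m₂, h4, h5, h6⟩ := hy.2 (d + 1) m₁ f l (by omega) (by omega)
    (hσ.trans h3 hd)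
  have h7 : m₂ (2 * d) = v := by rw [h6.reg (by omega)]; exact h2
  have hv := hx.1
  have hw := hy.1
  refine ⟨_, (h1.seq (h4.seq (runs_arith_reg (by omega) (by omega) (by omega) h7 h5 hv hw ho))).mono
    (by omega), ?_, (h3.trans h6 (by omega)).trans (agree_update le_rfl) le_rfl⟩
  simp

/-- `1` if `x < y`, and `0` otherwise. -/
def ltE (x y : Ex) : Ex := fun d =>
  .seq (x d) (.seq (y (d + 1)) (.ite (.cell (R d)) (.cell (R (d + 1))) (constE 1 d) (constE 0 d)))

theorem Has.lt (hx : Has E L Γ x v N h) (hy : Has E L Γ y w N' h') (hL : 1 ≤ L) :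
    Has E L Γ (ltE x y) (if v < w then 1 else 0) (N + N' + 3) (h + h' + 2) := by
  have hL' := Nat.one_lt_two_pow (n := L) (by omega)
  refine ⟨by split_ifs <;> omega, fun d m f l hd hh hσ => ?_⟩
  obtain ⟨m₁, h1, h2, h3⟩ := hx.2 d m f l hd (by omega) hσ
  obtain ⟨m₂, h4, h5, h6⟩ := hy.2 (d + 1) m₁ f l (by omega) (by omega)
    (hσ.trans h3 hd)
  have h7 : m₂ (2 * d) = v := by rw [h6.reg (by omega)]; exact h2
  have hv := hx.1
  have hw := hy.1
  have hc : ∀ b < 2 ^ L, Runs E L (constE b d) ⟨m₂, f, l⟩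
      (St.set ⟨m₂, f, l⟩ d b) 1 := fun b hb =>
    runs_move (by omega) rfl hb (by
      have := Nat.size_le.2 hb
      simp only [Operand.cost]
      omega)
  have hite : Runs E L (.ite (.cell (R d)) (.cell (R (d + 1))) (constE 1 d) (constE 0 d))
      ⟨m₂, f, l⟩ (St.set ⟨m₂, f, l⟩ d (if v < w then 1 else 0)) 3 := by
    refine Runs.ite (N := 1) hL ?_ ?_
    · have h8 := cost_reg_le (m := m₂) (r := d) (L := L) (by omega) (by omega)
      have h9 := cost_reg_le (m := m₂) (r := d + 1) (L := L) (by omega) (by omega)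
      unfold unit
      simp only
      nlinarith
    · simp only [Operand.val, R, Loc.addr, h7, h5]
      split_ifs
      · exact hc 1 hL'
      · exact hc 0 (by omega)
  refine ⟨_, (h1.seq (h4.seq hite)).mono (by omega), ?_,
    (h3.trans h6 (by omega)).trans (agree_update le_rfl) le_rfl⟩
  simp

/-- Compute `x`, then the expression `b` in which `x` may be used repeatedly. -/
def letE (x : Ex) (b : Ex → Ex) : Ex := fun d =>
  .seq (x d) (.seq (b (regE d) (d + 1)) (.instr (.move (R d) (.cell (R (d + 1))))))

/-- The body is verified for an arbitrary `X` of value `v` at unit cost in any larger context, so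
later proofs never mention the register that holds it. -/
theorem Has.letE {b : Ex → Ex} (hx : Has E L Γ x v N h)
    (hb : ∀ Γ' X, Γ ≤ Γ' → Has E L Γ' X v 1 1 → Has E L Γ' (b X) w N' h') :
    Has E L Γ (letE x b) w (N + N' + 1) (h + h' + 2) := by
  -- The bound on `w` is extracted from `hb` at an artificial context in which the next free
  -- register holds `v`.
  have hw : w < 2 ^ L := (hb ⟨Γ.D + 1, Function.update Γ.m (2 * Γ.D) v⟩ (regE Γ.D)
    ⟨by simp, agree_update le_rfl⟩ (.reg (by simp) (by simp) hx.1)).1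
  refine ⟨hw, fun d m f l hd hh hσ => ?_⟩
  obtain ⟨m₁, h1, h2, h3⟩ := hx.2 d m f l hd (by omega) hσ
  obtain ⟨m₂, h4, h5, h6⟩ := (hb ⟨d + 1, m₁⟩ (regE d) ⟨by simp; omega, hσ.trans h3 hd⟩
    (.reg (by simp) h2 hx.1)).2 (d + 1) m₁ f l le_rfl (by omega) (Agree.refl _ _)
  refine ⟨_, (h1.seq (h4.seq (runs_move_reg (by omega) (by omega) h5 hw))).mono
    (by omega), ?_, (h3.trans h6 (by omega)).trans (agree_update le_rfl) le_rfl⟩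
  simp

/-- Starting with the value of `s`, apply `n` times the function `b` of the value so far and of the
number of the round. -/
def foldE (n s : Ex) (b : Ex → Ex → Ex) : Ex := fun d =>
  .seq (s d) (.seq (n (d + 1)) (.seq (constE 0 (d + 2)) (countLoop (d + 2) (d + 1)
    (.seq (b (regE d) (regE (d + 2)) (d + 3)) (.instr (.move (R d) (.cell (R (d + 3)))))))))

/-- Registers `d`, `d + 1`, `d + 2` hold the accumulator, the number of rounds and the counter; the
body works from `d + 3` on. The `4` per round is the move back to the accumulator plus the loop
overhead of `3`. -/
theorem Has.fold {n s : Ex} {b : Ex → Ex → Ex} {nv Nn Ns Nb hn hs hb : ℕ} (F : ℕ → ℕ)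
    (Hn : Has E L Γ n nv Nn hn) (Hs : Has E L Γ s (F 0) Ns hs)
    (Hb : ∀ i < nv, ∀ Γ' X I, Γ ≤ Γ' → Has E L Γ' X (F i) 1 1 → Has E L Γ' I i 1 1 →
      Has E L Γ' (b X I) (F (i + 1)) Nb hb) :
    Has E L Γ (foldE n s b) (F nv) (Nn + Ns + 3 + nv * (Nb + 4)) (hn + hs + hb + 5) := by
  -- The bounds on the intermediate values need no separate hypothesis: they are contained in `Hb`,
  -- applied at artificial contexts.
  have hF : ∀ i ≤ nv, F i < 2 ^ L := by
    intro i
    induction i with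
    | zero => exact fun _ => Hs.1
    | succ i ih =>
      intro hi
      refine (Hb i (by omega) ⟨Γ.D + 2, Function.update (Function.update Γ.m (2 * Γ.D) (F i))
        (2 * (Γ.D + 1)) i⟩ (regE Γ.D) (regE (Γ.D + 1)) ⟨by simp, ?_⟩
        (.reg (by simp) ?_ (ih (by omega))) (.reg (by simp) (by simp) ?_)).1
      · exact (agree_update le_rfl).trans (agree_update le_rfl) (by omega)
      · simp
      · have := Hn.1; omega
  refine ⟨hF nv le_rfl, fun d m f l hd hh hσ => ?_⟩
  have hL := one_le_of_lt hh (by omega)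
  have hnv := Hn.1
  obtain ⟨m₁, h1, h2, h3⟩ := Hs.2 d m f l hd (by omega) hσ
  obtain ⟨m₂, h4, h5, h6⟩ := Hn.2 (d + 1) m₁ f l (by omega) (by omega)
    (hσ.trans h3 hd)
  obtain ⟨m₃, h7, h8, h9⟩ := (Has.const (Γ := ⟨0, m₂⟩) (v := 0) (E := E) (L := L) (by omega)).2
    (d + 2) m₂ f l (by simp) (by omega) (Agree.refl _ _)
  obtain ⟨σ', hr, m', rfl, ha, hacc, -, -⟩ := runs_countLoop (E := E) (L := L) (c := d + 2) (b := d + 1)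
    (s := .seq (b (regE d) (regE (d + 2)) (d + 3)) (.instr (.move (R d) (.cell (R (d + 3))))))
    (nv := nv) (Nb := Nb + 1)
    (Inv := fun i τ => ∃ m', τ = ⟨m', f, l⟩ ∧ Agree d m m' ∧ m' (2 * d) = F i ∧
      m' (2 * (d + 1)) = nv ∧ m' (2 * (d + 2)) = i) hL (by omega) (by omega) hnv
    (by rintro i _ ⟨m', rfl, -, -, h10, h11⟩; exact ⟨h11, h10⟩)
    (by
      rintro i hi _ ⟨m', rfl, g1, g2, g3, g4⟩
      obtain ⟨m'', g5, g6, g7⟩ := (Hb i hi ⟨d + 3, m'⟩ (regE d) (regE (d + 2))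
        ⟨by simp; omega, hσ.trans g1 hd⟩ (.reg (by simp) g2 (hF i hi.le))
        (.reg (by simp) g4 (by omega))).2 (d + 3) m' f l le_rfl (by omega)
        (Agree.refl _ _)
      have g8 := hF (i + 1) hi
      refine ⟨_, g5.seq (runs_move_reg (by omega) (by omega) g6 g8), ?_, _, rfl, ?_, ?_, ?_, ?_⟩
      · simp only
        rw [Function.update_of_ne (by omega), g7.reg (by omega), g4]
      · exact ((g1.trans g7 (by omega)).trans (agree_update le_rfl) le_rfl).trans
          (agree_update (by omega)) le_rfl
      · simp only
        rw [Function.update_of_ne (by omega), Function.update_self]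
      · simp only
        rw [Function.update_of_ne (by omega), Function.update_of_ne (by omega), g7.reg (by omega), g3]
      · simp)
    ⟨m₃, f, l⟩
    ⟨m₃, rfl, (h3.trans h6 (by omega)).trans h9 (by omega), by
      rw [h9.reg (by omega), h6.reg (by omega)]; exact h2, by rw [h9.reg (by omega), h5], h8⟩
  exact ⟨m', (h1.seq (h4.seq (h7.seq hr))).mono (by linarith), hacc, ha⟩

end RAM

namespace RAM

variable {E : Env} {L : ℕ} {Γ Γ' : Ctx} {x y : Ex} {v w N N' h h' : ℕ}

/-! ### Derived expressions -/

def addE : Ex → Ex → Ex := binE .add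
def subE : Ex → Ex → Ex := binE .sub
def mulE : Ex → Ex → Ex := binE .mul
def divE : Ex → Ex → Ex := binE .div
def modE : Ex → Ex → Ex := binE .mod

theorem Has.add (hx : Has E L Γ x v N h) (hy : Has E L Γ y w N' h') (ho : v + w < 2 ^ L) :
    Has E L Γ (addE x y) (v + w) (N + N' + 1) (h + h' + 2) := hx.bin hy ho

theorem Has.sub (hx : Has E L Γ x v N h) (hy : Has E L Γ y w N' h') :
    Has E L Γ (subE x y) (v - w) (N + N' + 1) (h + h' + 2) :=
  hx.bin hy ((Nat.sub_le v w).trans_lt hx.1)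

theorem Has.mul (hx : Has E L Γ x v N h) (hy : Has E L Γ y w N' h') (ho : v * w < 2 ^ L) :
    Has E L Γ (mulE x y) (v * w) (N + N' + 1) (h + h' + 2) := hx.bin hy ho

theorem Has.div (hx : Has E L Γ x v N h) (hy : Has E L Γ y w N' h') :
    Has E L Γ (divE x y) (v / w) (N + N' + 1) (h + h' + 2) :=
  hx.bin hy ((Nat.div_le_self v w).trans_lt hx.1)

theorem Has.mod (hx : Has E L Γ x v N h) (hy : Has E L Γ y w N' h') :
    Has E L Γ (modE x y) (v % w) (N + N' + 1) (h + h' + 2) :=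
  hx.bin hy ((Nat.mod_le v w).trans_lt hx.1)

def sumE (n : Ex) (b : Ex → Ex) : Ex := foldE n (constE 0) fun S I => addE S (b I)

theorem Has.sum {n : Ex} {b : Ex → Ex} {nv Nn Nb hn hb : ℕ} {f : ℕ → ℕ}
    (Hn : Has E L Γ n nv Nn hn) (hf : ∑ i ∈ Finset.range nv, f i < 2 ^ L)
    (Hb : ∀ i < nv, ∀ Γ' I, Γ ≤ Γ' → Has E L Γ' I i 1 1 → Has E L Γ' (b I) (f i) Nb hb) :
    Has E L Γ (sumE n b) (∑ i ∈ Finset.range nv, f i) (Nn + 4 + nv * (Nb + 6)) (hn + hb + 9) := by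
  refine (Has.fold (Nb := 1 + Nb + 1) (hb := 1 + hb + 2) (fun i => ∑ j ∈ Finset.range i, f j) Hn
    (Has.const (by simp)) fun i hi Γ' X I hΓ hX hI => ?_).mono
    (by rw [show 1 + Nb + 1 + 4 = Nb + 6 by omega]) (by omega)
  simp only [Finset.sum_range_succ]
  refine hX.add (Hb i hi Γ' I hΓ hI) (lt_of_le_of_lt ?_ hf)
  rw [← Finset.sum_range_succ]
  exact Finset.sum_le_sum_of_subset (by simpa using hi)

def prodE (n : Ex) (b : Ex → Ex) : Ex := foldE n (constE 1) fun S I => mulE S (b I)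

/-- All partial products are bounded by hypothesis: a later factor may be zero, so the full product
does not control them. -/
theorem Has.prod {n : Ex} {b : Ex → Ex} {nv Nn Nb hn hb : ℕ} {f : ℕ → ℕ}
    (Hn : Has E L Γ n nv Nn hn) (hf : ∀ i ≤ nv, ∏ j ∈ Finset.range i, f j < 2 ^ L)
    (Hb : ∀ i < nv, ∀ Γ' I, Γ ≤ Γ' → Has E L Γ' I i 1 1 → Has E L Γ' (b I) (f i) Nb hb) :
    Has E L Γ (prodE n b) (∏ i ∈ Finset.range nv, f i) (Nn + 4 + nv * (Nb + 6)) (hn + hb + 9) := by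
  refine (Has.fold (Nb := 1 + Nb + 1) (hb := 1 + hb + 2) (fun i => ∏ j ∈ Finset.range i, f j) Hn
    (Has.const (by simpa using hf 0 (by omega))) fun i hi Γ' X I hΓ hX hI => ?_).mono
    (by rw [show 1 + Nb + 1 + 4 = Nb + 6 by omega]) (by omega)
  simp only [Finset.prod_range_succ]
  refine hX.mul (Hb i hi Γ' I hΓ hI) ?_
  rw [← Finset.prod_range_succ]
  exact hf _ hi

def powE (x y : Ex) : Ex := prodE y fun _ => x

theorem Has.pow (hx : Has E L Γ x v N h) (hy : Has E L Γ y w N' h')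
    (ho : ∀ i ≤ w, v ^ i < 2 ^ L) :
    Has E L Γ (powE x y) (v ^ w) (N' + 4 + w * (N + 6)) (h + h' + 9) := by
  have := hy.prod (f := fun _ => v) (b := fun _ => x) (by simpa using ho)
    fun i _ Γ' I hΓ _ => hx.lift hΓ
  simp only [Finset.prod_const, Finset.card_range] at this
  exact this.mono le_rfl (by omega)

/-- The first `i < n` with `f i ≠ 0`; it is `n` if there is none (for `f` with values `0`, `1`). -/
def firstOne (f : ℕ → ℕ) : ℕ → ℕ
  | 0 => 0
  | n + 1 => firstOne f n + (1 - if firstOne f n < n then 1 else 0) * (1 - f n)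

/-- The recurrence has no branches: the value stays once it is below the number of rounds done, it
also stays if the current `f n` is `1`, and otherwise it grows by one. -/
theorem firstOne_spec {f : ℕ → ℕ} (n : ℕ) (hf : ∀ i < n, f i ≤ 1) : firstOne f n ≤ n ∧
    (∀ i < firstOne f n, f i = 0) ∧ (firstOne f n < n → f (firstOne f n) = 1) := by
  induction n with
  | zero => simp [firstOne]
  | succ n ih =>
    obtain ⟨h1, h2, h3⟩ := ih fun i hi => hf i (by omega)
    rcases h1.lt_or_eq with h | h
    · simp only [firstOne, h, if_true]
      exact ⟨by omega, by simpa using h2, fun _ => by simpa using h3 h⟩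
    · have h4 := hf n (by omega)
      simp only [firstOne, h, lt_irrefl, if_false]
      rcases Nat.le_one_iff_eq_zero_or_eq_one.1 h4 with h5 | h5
      · rw [h5]
        refine ⟨by omega, fun i hi => ?_, by omega⟩
        rcases Nat.lt_succ_iff_lt_or_eq.1 (show i < n + 1 by omega) with h6 | h6
        · exact h2 i (by omega)
        · rw [h6, h5]
      · rw [h5]
        exact ⟨by omega, fun i hi => h2 i (by omega), fun _ => by simpa using h5⟩

def firstE (n : Ex) (b : Ex → Ex) : Ex := foldE n (constE 0) fun S I =>
  addE S (mulE (subE (constE 1) (ltE S I)) (subE (constE 1) (b I)))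

theorem Has.first {n : Ex} {b : Ex → Ex} {nv Nn Nb hn hb : ℕ} {f : ℕ → ℕ} (hL : 1 ≤ L)
    (Hn : Has E L Γ n nv Nn hn) (hf : ∀ i < nv, f i ≤ 1)
    (Hb : ∀ i < nv, ∀ Γ' I, Γ ≤ Γ' → Has E L Γ' I i 1 1 → Has E L Γ' (b I) (f i) Nb hb) :
    Has E L Γ (firstE n b) (firstOne f nv) (Nn + 4 + nv * (Nb + 16)) (hn + hb + 30) := by
  have hL' := Nat.one_lt_two_pow (n := L) (by omega)
  refine (Has.fold (Nb := Nb + 12) (hb := hb + 15) (firstOne f) Hn (Has.const (by simp [firstOne]))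
    fun i hi Γ' X I hΓ hX hI => ?_).mono (by linarith) (by omega)
  refine (hX.add (((Has.const hL').sub (hX.lt hI hL)).mul
    ((Has.const hL').sub (Hb i hi Γ' I hΓ hI)) ?_) ?_).mono (by omega) (by omega)
  · exact (Nat.mul_le_mul (Nat.sub_le 1 _) (Nat.sub_le 1 _)).trans_lt hL'
  · exact ((firstOne_spec (i + 1) fun j hj => hf j (by omega)).1.trans hi).trans_lt Hn.1

/-- The bit length of `x`. -/
def sizeE (x : Ex) : Ex := foldE (addE x (constE 1)) (constE 0) fun S _ =>
  addE S (ltE (powE (constE 2) S) (addE x (constE 1)))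

/-- The accumulator `S` grows while `2 ^ S ≤ v`, that is, while `S < v.size`; `v + 1` rounds are
more than enough. Time about linear in `v` is affordable for `v = n ^ (k - k / 2)`. -/
theorem Has.size (hx : Has E L Γ x v 1 1) (hv : 2 * v + 2 < 2 ^ L) :
    Has E L Γ (sizeE x) v.size ((v + 1) * (7 * v.size + 18) + 7) 40 := by
  have hL : 1 ≤ L := by
    rcases Nat.eq_zero_or_pos L with rfl | h
    · simp at hv
    · exact h
  have h1 := Nat.one_lt_two_pow (n := L) (by omega)
  have hsize : v.size < 2 ^ L := (Nat.size_le.2 (Nat.lt_two_pow_self (n := v))).trans_lt (by omega)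
  have := Has.fold (Nb := 7 * v.size + 14) (hb := 27) (b := fun S _ =>
    addE S (ltE (powE (constE 2) S) (addE x (constE 1)))) (fun i => min i v.size)
    (hx.add (Has.const h1) (by omega)) (Has.const (by simp)) fun i hi Γ' X I hΓ hX hI => ?_
  · have h2 : v.size ≤ v := Nat.size_le.2 (Nat.lt_two_pow_self (n := v))
    simp only [show min (v + 1) v.size = v.size by omega] at this
    exact this.mono (by linarith) (by omega)
  · have hpow : ∀ j ≤ min i v.size, 2 ^ j < 2 ^ L := by
      intro j hj
      rcases Nat.eq_zero_or_pos j with rfl | hj0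
      · simpa using h1
      · have h3 : 2 ^ (j - 1) ≤ v := by
          rw [← Nat.lt_size]
          omega
        have h4 : 2 ^ j = 2 * 2 ^ (j - 1) := by rw [← pow_succ']; congr 1; omega
        omega
    have hval : min (i + 1) v.size = min i v.size + if 2 ^ min i v.size < v + 1 then 1 else 0 := by
      simp only [Nat.lt_succ_iff, ← Nat.lt_size]
      split_ifs <;> omega
    have h5 := (Has.const (E := E) (Γ := Γ') (v := 2) (by omega)).pow hX hpow
    have h6 := h5.lt ((hx.lift hΓ).add (Has.const h1) (by omega)) hL
    have h7 : min i v.size ≤ v.size := by omega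
    rw [hval]
    exact (hX.add h6 (by rw [← hval]; omega)).mono (by omega) (by omega)

/-! ### Loops that emit or flip coins, and whole programs -/

/-- Emit the values of `e` on the numbers below `x`. -/
def emitLoop (x : Ex) (e : Ex → Ex) (d : ℕ) : Code :=
  .seq (x d) (.seq (constE 0 (d + 1)) (countLoop (d + 1) d
    (.seq (e (regE (d + 1)) (d + 2)) (.instr (.emit (.cell (R (d + 2))))))))

theorem runs_emitLoop {e : Ex → Ex} {Nb hb d fl : ℕ} {f m : ℕ → ℕ} {l : List ℕ}
    (Hx : Has E L Γ x v N h)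
    (He : ∀ i < v, ∀ Γ' I, Γ ≤ Γ' → Has E L Γ' I i 1 1 → Has E L Γ' (e I) (f i) Nb hb)
    (hd : Γ.D ≤ d) (hdL : 2 * (d + (h + hb + 3)) < 2 ^ L) (hm : Agree Γ.D Γ.m m) :
    ∃ m', Runs E L (emitLoop x e d) ⟨m, fl, l⟩ ⟨m', fl, l ++ (List.range v).map f⟩
      (N + 3 + v * (Nb + 4)) ∧ Agree d m m' := by
  have hL := one_le_of_lt hdL (by omega)
  have hv := Hx.1
  obtain ⟨m₁, h1, h2, h3⟩ := Hx.2 d m fl l hd (by omega) hm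
  obtain ⟨m₂, h4, h5, h6⟩ := (Has.const (Γ := ⟨0, m₁⟩) (v := 0) (E := E) (L := L) (by omega)).2
    (d + 1) m₁ fl l (by simp) (by omega) (Agree.refl _ _)
  obtain ⟨σ', hr, m', rfl, ha, -⟩ := runs_countLoop (E := E) (L := L) (c := d + 1) (b := d)
    (s := .seq (e (regE (d + 1)) (d + 2)) (.instr (.emit (.cell (R (d + 2))))))
    (nv := v) (Nb := Nb + 1)
    (Inv := fun i τ => ∃ m', τ = ⟨m', fl, l ++ (List.range i).map f⟩ ∧ Agree d m m' ∧
      m' (2 * d) = v ∧ m' (2 * (d + 1)) = i) hL (by omega) (by omega) hv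
    (by rintro i _ ⟨m', rfl, -, h10, h11⟩; exact ⟨h11, h10⟩)
    (by
      rintro i hi _ ⟨m', rfl, g1, g3, g4⟩
      have hI := He i hi ⟨d + 2, m'⟩ (regE (d + 1)) ⟨by simp; omega, hm.trans g1 hd⟩
        (.reg (by simp) g4 (by omega))
      obtain ⟨m'', g5, g6, g7⟩ := hI.2 (d + 2) m' fl (l ++ (List.range i).map f) le_rfl (by omega)
        (Agree.refl _ _)
      refine ⟨_, g5.seq (runs_emit (σ := ⟨m'', fl, _⟩) (by omega) g6 hI.1), ?_,
        Function.update m'' (2 * (d + 1)) (i + 1), ?_, ?_, ?_, ?_⟩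
      · simp only
        rw [g7.reg (by omega), g4]
      · simp [St.set, List.range_succ]
      · exact (g1.trans g7 (by omega)).trans (agree_update (by omega)) le_rfl
      · rw [Function.update_of_ne (by omega), g7.reg (by omega), g3]
      · simp)
    ⟨m₂, fl, l⟩
    ⟨m₂, by simp, h3.trans h6 (by omega), by rw [h6.reg (by omega), h2], h5⟩
  exact ⟨m', (h1.seq (h4.seq hr)).mono (by linarith), ha⟩

/-- Flip `x` coins and store them in the cells with odd addresses. -/
def coinLoop (x : Ex) (d : ℕ) : Code :=
  .seq (x d) (.seq (constE 0 (d + 1)) (countLoop (d + 1) d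
    (.seq (addE (mulE (constE 2) (regE (d + 1))) (constE 1) (d + 2))
      (.instr (.coin (.ind (2 * (d + 2))))))))

/-- Starting from zero flips, the counter equals the number of flips, so coin `i` lands in cell `2 *
i + 1`. The table changes, hence only the registers below `d` are claimed to be preserved. -/
theorem runs_coinLoop {d : ℕ} {m : ℕ → ℕ} {l : List ℕ} (Hx : Has E L Γ x v N h)
    (hd : Γ.D ≤ d) (hdL : 2 * (d + (h + 10)) < 2 ^ L) (hvL : 2 * v + 1 < 2 ^ L)
    (hm : Agree Γ.D Γ.m m) :
    ∃ m', Runs E L (coinLoop x d) ⟨m, 0, l⟩ ⟨m', v, l⟩ (N + 3 + v * 9) ∧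
      (∀ r < d, m' (2 * r) = m (2 * r)) ∧ ∀ i < v, m' (2 * i + 1) = (E.coins i).toNat := by
  have hL := one_le_of_lt hdL (by omega)
  have hv := Hx.1
  obtain ⟨m₁, h1, h2, h3⟩ := Hx.2 d m 0 l hd (by omega) hm
  obtain ⟨m₂, h4, h5, h6⟩ := (Has.const (Γ := ⟨0, m₁⟩) (v := 0) (E := E) (L := L) (by omega)).2
    (d + 1) m₁ 0 l (by simp) (by omega) (Agree.refl _ _)
  obtain ⟨σ', hr, m', rfl, ha, -, -, hcoin⟩ := runs_countLoop (E := E) (L := L) (c := d + 1) (b := d)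
    (s := .seq (addE (mulE (constE 2) (regE (d + 1))) (constE 1) (d + 2))
      (.instr (.coin (.ind (2 * (d + 2))))))
    (nv := v) (Nb := 6)
    (Inv := fun i τ => ∃ m', τ = ⟨m', i, l⟩ ∧ (∀ r < d, m' (2 * r) = m (2 * r)) ∧
      m' (2 * d) = v ∧ m' (2 * (d + 1)) = i ∧ ∀ j < i, m' (2 * j + 1) = (E.coins j).toNat)
    hL (by omega) (by omega) hv
    (by rintro i _ ⟨m', rfl, -, h10, h11, -⟩; exact ⟨h11, h10⟩)
    (by
      rintro i hi _ ⟨m', rfl, g1, g3, g4, g8⟩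
      have hI : Has E L ⟨d + 2, m'⟩ (regE (d + 1)) i 1 1 := .reg (by simp) g4 (by omega)
      obtain ⟨m'', g5, g6, g7⟩ := (((Has.const (v := 2) (by omega)).mul hI (by omega)).add
        (Has.const (v := 1) (by omega)) (by omega)).2 (d + 2) m' i l le_rfl (by omega)
        (Agree.refl _ _)
      refine ⟨_, g5.seq (runs_coin (σ := ⟨m'', i, l⟩) (by omega) g6 (by omega) hL), ?_,
        _, rfl, ?_, ?_, ?_, ?_⟩
      · simp only
        rw [Function.update_of_ne (by omega), g7.reg (by omega), g4]
      · intro r hr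
        simp only
        rw [Function.update_of_ne (by omega), Function.update_of_ne (by omega), g7.reg (by omega),
          g1 r hr]
      · simp only
        rw [Function.update_of_ne (by omega), Function.update_of_ne (by omega), g7.reg (by omega),
          g3]
      · simp
      · intro j hj
        simp only
        rw [Function.update_of_ne (by omega)]
        rcases Nat.lt_succ_iff_lt_or_eq.1 hj with h | rfl
        · rw [Function.update_of_ne (by omega), g7 _ (by omega), g8 j h]
        · simp)
    ⟨m₂, 0, l⟩
    ⟨m₂, rfl, fun r hr => by rw [h6.reg (by omega), h3.reg hr], by rw [h6.reg (by omega), h2], h5,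
      by simp⟩
  exact ⟨m', (h1.seq (h4.seq hr)).mono (by linarith), ha, hcoin⟩

/-- Run `s`, then accept if register `ok` is not zero. -/
def Code.program (s : Code) (ok : ℕ) : Program :=
  s.compile 0 ++ [.jumpLT (.const 0) (.cell (R ok)) (s.len + 2), .reject, .accept]

theorem Runs.haltsIn {s : Code} {ok f : ℕ} {m : ℕ → ℕ} {l : List ℕ}
    (hs : Runs E L s ⟨E.start.mem, 0, []⟩ ⟨m, f, l⟩ N) (hok : 2 * ok < 2 ^ L)
    (hv : m (2 * ok) < 2 ^ L) :
    HaltsIn (s.program ok) E ((N + 1) * unit L) (if 0 < m (2 * ok) then some l else none) := by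
  have hloc : Located (s.program ok) (s.program ok) 0 := by
    simpa using located_self [] (s.program ok)
  have hloc' := hloc
  nth_rw 2 [Code.program] at hloc'
  rw [located_append, Code.length_compile] at hloc'
  simp only [Located, zero_add] at hloc'
  obtain ⟨hs', hj, hrej, hacc, -⟩ := hloc'
  obtain ⟨τ, hτ, t, ht⟩ := hs _ 0 0 hs'
  rw [zero_add] at ht
  have hstart : E.start = St.toConfig ⟨E.start.mem, 0, []⟩ 0 0 := rfl
  have hstep := step_jumpLT (E := E) (τ := τ) ⟨m, f, l⟩ hj
  have hend : (step (s.program ok) E)^[1 + t] E.start =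
      step (s.program ok) E (St.toConfig ⟨m, f, l⟩ s.len τ) := by
    rw [Function.iterate_add_apply, hstart, ht, Function.iterate_one]
  rw [hstep] at hend
  have hcost := cost_reg_le (m := m) hok hv
  have hτ' : τ + (1 + (Operand.const 0).cost m + (Operand.cell (R ok)).cost m) ≤
      (N + 1) * unit L := by
    have h1 : (Operand.const 0).cost m = 0 := Nat.size_zero
    have h2 : 1 + 2 * L ≤ unit L := by unfold unit; nlinarith
    nlinarith
  obtain ⟨pc, hpc, hend⟩ : ∃ pc, (s.program ok)[pc]? =
      some (if 0 < m (2 * ok) then .accept else .reject) ∧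
      (step (s.program ok) E)^[1 + t] E.start = St.toConfig ⟨m, f, l⟩ pc
        (τ + (1 + (Operand.const 0).cost m + (Operand.cell (R ok)).cost m)) := by
    by_cases h0 : 0 < m (2 * ok)
    · rw [if_pos (by exact h0)] at hend
      exact ⟨_, by rw [if_pos h0]; exact hacc, hend⟩
    · rw [if_neg (by exact h0)] at hend
      exact ⟨_, by rw [if_neg h0]; exact hrej, hend⟩
  refine ⟨1 + t, ?_, ?_, ?_⟩ <;> rw [hend]
  · simp only [Config.Halted, St.toConfig, hpc]
    split_ifs <;> simp
  · exact hτ'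
  · by_cases h0 : 0 < m (2 * ok)
    · rw [if_pos h0] at hpc ⊢
      exact if_pos hpc
    · rw [if_neg h0] at hpc ⊢
      exact if_neg (by simp [St.toConfig, hpc])

theorem HaltsIn.congr_result {p : Program} {T : ℕ} {a b : Option (List ℕ)}
    (h : HaltsIn p E T a) (hab : a = b) : HaltsIn p E T b := hab ▸ h

end RAM

/-! ### Tuples of vertices as numbers -/

namespace CliqueCode

/-- Digit number `i` of `Z` in base `n`. -/
def dig (n Z i : ℕ) : ℕ := Z / n ^ i % n

/-- The `l` lowest digits of `Z` in base `n`, the most significant one first. -/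
def tup (n l Z : ℕ) : List ℕ := (List.range l).map fun i => dig n Z (l - 1 - i)

/-- For a relation `r` given by its characteristic function: `1` if the `l` lowest digits of `Z`,
the most significant one first, are pairwise related, and `0` otherwise. -/
def chain (n : ℕ) (r : ℕ → ℕ → ℕ) (Z l : ℕ) : ℕ :=
  ∏ i ∈ Finset.range l, ∏ j ∈ Finset.range i, r (dig n Z i) (dig n Z j)

/-- `1` if the `a` lowest digits of `X` are related to `v`, and `0` otherwise. -/
def common (n : ℕ) (r : ℕ → ℕ → ℕ) (a X v : ℕ) : ℕ := ∏ i ∈ Finset.range a, r (dig n X i) v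

variable {n : ℕ} {r : ℕ → ℕ → ℕ}

/-! ### Digits of concatenated tuples. -/

theorem dig_lt (hn : 0 < n) (Z i : ℕ) : dig n Z i < n := Nat.mod_lt _ hn

theorem dig_low (hn : 0 < n) {X T b i : ℕ} (hi : i < b) :
    dig n (X * n ^ b + T) i = dig n T i := by
  obtain ⟨c, rfl⟩ := Nat.exists_eq_add_of_lt hi
  have h : X * n ^ (i + c + 1) + T = T + n ^ i * (n * (X * n ^ c)) := by ring
  rw [dig, h, Nat.add_mul_div_left _ _ (by positivity), Nat.add_mul_mod_self_left]
  rfl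

theorem dig_high (hn : 0 < n) {X T b : ℕ} (hT : T < n ^ b) (i : ℕ) :
    dig n (X * n ^ b + T) (b + i) = dig n X i := by
  have h : (X * n ^ b + T) / n ^ b = X := by
    rw [Nat.add_comm, Nat.add_mul_div_right _ _ (by positivity), Nat.div_eq_of_lt hT, zero_add]
  rw [dig, pow_add, ← Nat.div_div_eq_div_mul, h]
  rfl

/-- The pairs of positions `j < i` are both low, both high, or mixed. The mixed pairs, grouped by
their low position, give the factors `common`. -/
theorem chain_split (hn : 0 < n) {X T a b : ℕ} (hT : T < n ^ b) :
    chain n r (X * n ^ b + T) (b + a) =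
      chain n r T b * (chain n r X a * ∏ j ∈ Finset.range b, common n r a X (dig n T j)) := by
  unfold chain common
  rw [Finset.prod_range_add, Finset.prod_comm (s := Finset.range b) (t := Finset.range a),
    mul_comm (∏ i ∈ Finset.range a, _) (∏ i ∈ Finset.range a, _), ← Finset.prod_mul_distrib]
  congr 1
  · refine Finset.prod_congr rfl fun i hi => Finset.prod_congr rfl fun j hj => ?_
    rw [Finset.mem_range] at hi hj
    rw [dig_low hn hi, dig_low hn (hj.trans hi)]
  · refine Finset.prod_congr rfl fun i hi => ?_
    rw [Finset.prod_range_add, dig_high hn hT]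
    congr 1
    · refine Finset.prod_congr rfl fun j hj => ?_
      rw [dig_low hn (Finset.mem_range.1 hj)]
    · refine Finset.prod_congr rfl fun j hj => ?_
      rw [dig_high hn hT]

/-! ### Sums over all tuples. -/

theorem sum_range_mul {M : Type*} [AddCommMonoid M] (f : ℕ → M) (m p : ℕ) :
    ∑ Z ∈ Finset.range (m * p), f Z =
      ∑ X ∈ Finset.range m, ∑ T ∈ Finset.range p, f (X * p + T) := by
  induction m with
  | zero => simp
  | succ m ih => rw [add_mul, one_mul, Finset.sum_range_add, ih, Finset.sum_range_succ]

/-- The distributive law: choosing `T` means choosing its `b` digits independently. The induction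
splits off the top digit. -/
theorem sum_prod_dig {A : Type*} [CommSemiring A] (hn : 0 < n) (u : ℕ → ℕ → A) (b : ℕ) :
    ∑ T ∈ Finset.range (n ^ b), ∏ j ∈ Finset.range b, u j (dig n T j) =
      ∏ j ∈ Finset.range b, ∑ v ∈ Finset.range n, u j v := by
  induction b with
  | zero => simp
  | succ b ih =>
    rw [pow_succ', sum_range_mul, Finset.prod_range_succ, ← ih, Finset.sum_mul_sum, Finset.sum_comm]
    refine Finset.sum_congr rfl fun T hT => Finset.sum_congr rfl fun X hX => ?_
    rw [Finset.mem_range] at hT hX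
    rw [Finset.prod_range_succ]
    congr 1
    · refine Finset.prod_congr rfl fun j hj => ?_
      rw [dig_low hn (Finset.mem_range.1 hj)]
    · have := dig_high hn (X := X) hT 0
      rw [add_zero] at this
      rw [this, dig, pow_zero, Nat.div_one, Nat.mod_eq_of_lt hX]

/-- The number of `X < x` whose digits form a chain that is related to all digits of `T`. -/
def count (n : ℕ) (r : ℕ → ℕ → ℕ) (a b x T : ℕ) : ℕ :=
  ∑ X ∈ Finset.range x, chain n r X a * ∏ j ∈ Finset.range b, common n r a X (dig n T j)

/-- Exchange the sums and apply `sum_prod_dig` to the inner one. The right-hand side has about `x *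
b * n` terms instead of `x * n ^ b`; the verifier's running time rests on this. -/
theorem sum_count (hn : 0 < n) (u : ℕ → ℕ → ℕ) (a b x : ℕ) :
    ∑ T ∈ Finset.range (n ^ b), count n r a b x T * ∏ j ∈ Finset.range b, u j (dig n T j) =
      ∑ X ∈ Finset.range x, chain n r X a *
        ∏ j ∈ Finset.range b, ∑ v ∈ Finset.range n, common n r a X v * u j v := by
  simp only [count, Finset.sum_mul, ← sum_prod_dig hn, Finset.mul_sum, Finset.prod_mul_distrib]
  rw [Finset.sum_comm]
  simp only [mul_assoc]

theorem prod_le_one_of {ι : Type*} {s : Finset ι} {f : ι → ℕ} (h : ∀ i ∈ s, f i ≤ 1) :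
    ∏ i ∈ s, f i ≤ 1 :=
  Finset.prod_le_one' h

theorem chain_le_one (hr : ∀ u v, r u v ≤ 1) (Z l : ℕ) : chain n r Z l ≤ 1 :=
  prod_le_one_of fun _ _ => prod_le_one_of fun _ _ => hr _ _

theorem common_le_one (hr : ∀ u v, r u v ≤ 1) (a X v : ℕ) : common n r a X v ≤ 1 :=
  prod_le_one_of fun _ _ => hr _ _

theorem count_le (hr : ∀ u v, r u v ≤ 1) (a b x T : ℕ) : count n r a b x T ≤ x := by
  refine (Finset.sum_le_card_nsmul _ _ 1 fun X _ => ?_).trans (by simp)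
  exact (Nat.mul_le_mul (chain_le_one hr X a)
    (prod_le_one_of fun j _ => common_le_one hr a X _)).trans (by simp)

theorem prod_eq_one_iff_of_le {ι : Type*} {s : Finset ι} {f : ι → ℕ} :
    ∏ i ∈ s, f i = 1 ↔ ∀ i ∈ s, f i = 1 := by
  simp [Finset.prod_eq_one_iff]

theorem chain_eq_one_iff {Z l : ℕ} :
    chain n r Z l = 1 ↔ (tup n l Z).Pairwise fun u v => r u v = 1 := by
  rw [tup, List.pairwise_map, List.pairwise_iff_getElem]
  simp only [chain, prod_eq_one_iff_of_le, Finset.mem_range, List.length_range, List.getElem_range]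
  constructor
  · intro h i j _ hj hij
    exact h _ (by omega) _ (by omega)
  · intro h i hi j hj
    have := h (l - 1 - i) (l - 1 - j) (by omega) (by omega) (by omega)
    rwa [show l - 1 - (l - 1 - i) = i by omega, show l - 1 - (l - 1 - j) = j by omega] at this

/-! ### Tuples, their codes and the lexicographic order. -/

theorem tup_succ (n l Z : ℕ) : tup n (l + 1) Z = dig n Z l :: tup n l Z := by
  simp only [tup, List.range_succ_eq_map, List.map_cons, List.map_map]
  congr 1
  refine List.map_congr_left fun i hi => ?_
  simp only [Function.comp, Nat.succ_eq_add_one]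
  congr 1
  omega

theorem tup_lex {l Z Z' : ℕ} (h : Z % n ^ l ≤ Z' % n ^ l) :
    tup n l Z = tup n l Z' ∨ List.Lex (· < ·) (tup n l Z) (tup n l Z') := by
  induction l with
  | zero => simp [tup]
  | succ l ih =>
    rw [tup_succ, tup_succ]
    rw [Nat.mod_pow_succ, Nat.mod_pow_succ] at h
    change Z % n ^ l + n ^ l * dig n Z l ≤ Z' % n ^ l + n ^ l * dig n Z' l at h
    rcases lt_trichotomy (dig n Z l) (dig n Z' l) with hd | hd | hd
    · exact .inr (.rel hd)
    · rw [hd] at h ⊢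
      rcases ih (by omega) with h1 | h1
      · exact .inl (by rw [h1])
      · exact .inr (.cons h1)
    · exfalso
      -- A smaller top digit of `Z'` outweighs all lower digits, but in base `0` the lower part is
      -- not bounded by `n ^ l`, so that base is excluded by hand.
      rcases Nat.eq_zero_or_pos n with rfl | hn
      · rcases Nat.eq_zero_or_pos l with rfl | hl
        · simp [Nat.mod_one] at h; omega
        · simp [dig, hl.ne'] at hd
      · have h1 : Z' % n ^ l < n ^ l := Nat.mod_lt _ (by positivity)
        have h2 := Nat.mul_le_mul_left (n ^ l) (Nat.succ_le_of_lt hd)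
        rw [Nat.mul_succ] at h2
        linarith [Nat.zero_le (Z % n ^ l)]

/-- Every list of `l` numbers less than `n` is of the form `tup n l Z`. -/
theorem exists_tup (y : List ℕ) (hy : ∀ v ∈ y, v < n) :
    ∃ Z < n ^ y.length, tup n y.length Z = y := by
  induction y with
  | nil => exact ⟨0, by simp, rfl⟩
  | cons v y ih =>
    obtain ⟨Z, hZ, h⟩ := ih fun w hw => hy w (by simp [hw])
    have hv := hy v (by simp)
    have hn : 0 < n := by omega
    refine ⟨v * n ^ y.length + Z, ?_, ?_⟩
    · rw [List.length_cons, pow_succ']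
      calc v * n ^ y.length + Z < v * n ^ y.length + n ^ y.length := by omega
        _ = (v + 1) * n ^ y.length := by ring
        _ ≤ n * n ^ y.length := Nat.mul_le_mul_right _ hv
    · rw [List.length_cons, tup_succ]
      congr 1
      · have := dig_high hn (X := v) hZ 0
        rw [add_zero] at this
        rw [this, dig, pow_zero, Nat.div_one, Nat.mod_eq_of_lt hv]
      · refine Eq.trans (List.map_congr_left fun i hi => ?_) h
        have := List.mem_range.1 hi
        exact dig_low hn (by omega)

/-! ### Cliques of a graph -/

/-- `1` if `u < v` and entry `u * n + v` of the encoded adjacency matrix is set, otherwise `0`. -/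
def rel (n : ℕ) (M : List Bool) (u v : ℕ) : ℕ :=
  (if u < v then 1 else 0) * (M.getD (u * n + v) false).toNat

theorem rel_le_one (n : ℕ) (M : List Bool) (u v : ℕ) : rel n M u v ≤ 1 := by
  unfold rel
  have := Bool.toNat_le (M.getD (u * n + v) false)
  split_ifs <;> omega

theorem rel_eq_one_iff {k : ℕ} (G : (kClique k).Inst) (u v : Fin G.1) :
    rel G.1 ((kClique k).encode G) u v = 1 ↔ u < v ∧ G.2.Adj u v := by
  classical
  have hlt : (u : ℕ) * G.1 + v < G.1 * G.1 := by
    calc (u : ℕ) * G.1 + v < u * G.1 + G.1 := by omega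
      _ = (u + 1) * G.1 := by ring
      _ ≤ G.1 * G.1 := Nat.mul_le_mul_right _ u.2
  have h : ((kClique k).encode G).getD (u * G.1 + v) false = decide (G.2.Adj u v) := by
    have h1 : Fin.divNat (⟨(u : ℕ) * G.1 + v, hlt⟩ : Fin (G.1 * G.1)) = u := by
      ext
      simp only [Fin.coe_divNat]
      rw [mul_comm, Nat.mul_add_div (by omega), Nat.div_eq_of_lt v.2, add_zero]
    have h2 : Fin.modNat (⟨(u : ℕ) * G.1 + v, hlt⟩ : Fin (G.1 * G.1)) = v := by
      ext
      simp only [Fin.coe_modNat]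
      rw [mul_comm, Nat.mul_add_mod, Nat.mod_eq_of_lt v.2]
    rw [List.getD_eq_getElem _ _ (by simpa [kClique] using hlt)]
    simp only [kClique, List.getElem_ofFn, h1, h2]
  rw [rel, h]
  by_cases h1 : u < v <;> by_cases h2 : G.2.Adj u v <;> simp [h1, h2]

/-- In `kClique` the coercion to `ℕ` is elaborated as a lift of the whole list in the list monad,
followed by an identity map. -/
theorem map_id_coe {n : ℕ} (l : List (Fin n)) :
    (List.map (fun v => v) do
      let a ← l
      pure (a : ℕ)) = l.map Fin.val := by
  induction l with
  | nil => rfl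
  | cons a l ih => simpa using ih

theorem sol_iff {k : ℕ} (G : (kClique k).Inst) (y : List ℕ) :
    (kClique k).Sol G y ↔ ∃ l : List (Fin G.1), l.length = k ∧
      (l.Pairwise fun u v => u < v ∧ G.2.Adj u v) ∧ y = l.map Fin.val := by
  classical
  constructor
  · rintro ⟨s, hs, rfl⟩
    refine ⟨s.sort (· ≤ ·), by simpa using hs.card_eq, ?_, map_id_coe _⟩
    have h1 : (s.sort (· ≤ ·)).Pairwise (· < ·) := s.sortedLT_sort.pairwise
    refine h1.imp_of_mem fun {u v} hu hv huv => ⟨huv, hs.isClique ?_ ?_ huv.ne⟩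
    · simpa using hu
    · simpa using hv
  · rintro ⟨l, hl, hp, rfl⟩
    have hlt : l.Pairwise (· < ·) := hp.imp fun h => h.1
    have hnd : l.Nodup := hlt.imp fun h => h.ne
    refine ⟨l.toFinset, ⟨?_, by rw [List.toFinset_card_of_nodup hnd, hl]⟩, ?_⟩
    · intro u hu v hv huv
      simp only [Finset.mem_coe, List.mem_toFinset] at hu hv
      have : Std.Symm G.2.Adj := ⟨fun _ _ h => h.symm⟩
      exact (hp.imp (S := G.2.Adj) fun h => h.2).forall hu hv huv
    · rw [(List.toFinset_sort (· ≤ ·) hnd).2 (hlt.imp fun h => h.le)]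
      exact (map_id_coe l).symm

/-- Reduces the search for cliques to a search among numbers; by `tup_lex` the least code is that of
the lexicographically first clique. -/
theorem sol_iff_exists_tup {k : ℕ} (G : (kClique k).Inst) (y : List ℕ) :
    (kClique k).Sol G y ↔ ∃ Z < G.1 ^ k,
      chain G.1 (rel G.1 ((kClique k).encode G)) Z k = 1 ∧ y = tup G.1 k Z := by
  rw [sol_iff]
  constructor
  · rintro ⟨l, hl, hp, rfl⟩
    obtain ⟨Z, hZ, h⟩ := exists_tup (n := G.1) (l.map Fin.val) (by simp)
    rw [List.length_map, hl] at hZ h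
    refine ⟨Z, hZ, ?_, h.symm⟩
    rw [chain_eq_one_iff, h, List.pairwise_map]
    exact hp.imp fun h => (rel_eq_one_iff G _ _).2 h
  · rintro ⟨Z, hZ, hc, rfl⟩
    rcases Nat.eq_zero_or_pos k with rfl | hk
    · exact ⟨[], rfl, by simp, by simp [tup]⟩
    have hn : 0 < G.1 := by
      by_contra h
      rw [show G.1 = 0 by omega, zero_pow hk.ne'] at hZ
      omega
    refine ⟨(List.range k).map fun i => (⟨dig G.1 Z (k - 1 - i), dig_lt hn _ _⟩ : Fin G.1), by simp, ?_,
      by simp [tup]⟩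
    rw [chain_eq_one_iff, tup, List.pairwise_map] at hc
    rw [List.pairwise_map]
    exact hc.imp fun h => (rel_eq_one_iff G _ _).1 h

end CliqueCode

/-! ### Random multilinear forms -/

namespace CliqueCode

/-- The number with the bits `f 0, …, f (m - 1)`, the least significant one first. -/
def bitsVal (m : ℕ) (f : ℕ → Bool) : ℕ := ∑ l ∈ Finset.range m, (f l).toNat * 2 ^ l

theorem bitsVal_succ (m : ℕ) (f : ℕ → Bool) :
    bitsVal (m + 1) f = 2 * bitsVal m (fun l => f (l + 1)) + (f 0).toNat := by
  simp only [bitsVal, Finset.sum_range_succ', pow_zero, mul_one, Finset.mul_sum, pow_succ]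
  congr 1
  exact Finset.sum_congr rfl fun _ _ => by ring

theorem bitsVal_lt (m : ℕ) (f : ℕ → Bool) : bitsVal m f < 2 ^ m := by
  induction m generalizing f with
  | zero => simp [bitsVal]
  | succ m ih =>
    have h1 := ih fun l => f (l + 1)
    have h2 := Bool.toNat_le (f 0)
    rw [bitsVal_succ, pow_succ]
    omega

theorem bitsVal_inj {m : ℕ} {f g : ℕ → Bool} (h : bitsVal m f = bitsVal m g) :
    ∀ l < m, f l = g l := by
  induction m generalizing f g with
  | zero => omega
  | succ m ih =>
    rw [bitsVal_succ, bitsVal_succ] at h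
    have h1 := Bool.toNat_le (f 0)
    have h2 := Bool.toNat_le (g 0)
    intro l hl
    rcases l with - | l
    · have h3 : (f 0).toNat = (g 0).toNat := by omega
      cases hf : f 0 <;> cases hg : g 0 <;> simp_all
    · exact ih (f := fun l => f (l + 1)) (g := fun l => g (l + 1)) (by omega) l (by omega)

theorem bitsVal_testBit {m v : ℕ} {f : ℕ → Bool} (hv : v < 2 ^ m)
    (hf : ∀ l < m, (f l).toNat = v / 2 ^ l % 2) : bitsVal m f = v := by
  induction m generalizing v f with
  | zero => simp [bitsVal]; omega
  | succ m ih =>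
    rw [bitsVal_succ, ih (v := v / 2), hf 0 (by omega)]
    · simp; omega
    · rw [pow_succ] at hv; omega
    · intro l hl
      rw [hf (l + 1) (by omega), pow_succ', Nat.div_div_eq_div_mul]

/-- The `i`-th random number, composed of `m` coins. -/
def coinVal (m : ℕ) (c : ℕ → Bool) (i : ℕ) : ℕ := bitsVal m fun l => c (i * m + l)

theorem mod_pow_eq_of_dig {n b T T' : ℕ} (h : ∀ j < b, dig n T j = dig n T' j) :
    T % n ^ b = T' % n ^ b := by
  induction b with
  | zero => simp [Nat.mod_one]
  | succ b ih =>
    rw [Nat.mod_pow_succ, Nat.mod_pow_succ, ih fun j hj => h j (by omega)]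
    have := h b (by omega)
    unfold dig at this
    rw [this]

/-- The value of the multilinear form with coefficients `t` at the point `u`. -/
def form (n b : ℕ) (t : ℕ → ℤ) (u : ℕ → ℤ) : ℤ :=
  ∑ T ∈ Finset.range (n ^ b), t T * ∏ j ∈ Finset.range b, u (j * n + dig n T j)

theorem idx_lt {n b j v : ℕ} (hj : j < b) (hv : v < n) : j * n + v < b * n := by
  calc j * n + v < j * n + n := by omega
    _ = (j + 1) * n := by ring
    _ ≤ b * n := Nat.mul_le_mul_right _ hj

theorem idx_mod {n j v : ℕ} (hv : v < n) : (j * n + v) % n = v := by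
  rw [mul_comm, Nat.mul_add_mod, Nat.mod_eq_of_lt hv]

theorem idx_div {n j v : ℕ} (hv : v < n) : (j * n + v) / n = j := by
  rw [mul_comm, Nat.mul_add_div (by omega), Nat.div_eq_of_lt hv, add_zero]

-- Schwartz–Zippel on the cube of side `2 ^ m`, with variable `j * n + v` for the random number
-- attached to position `j` and vertex `v`. The degree is at most `b`, so the proportion of zeros is
-- at most `b / 2 ^ m ≤ 1 / 3`.
open MvPolynomial in
theorem card_form_eq_zero_le {n b m : ℕ} (hn : 0 < n) (hm : 3 * b ≤ 2 ^ m) {t : ℕ → ℤ} {T₀ : ℕ}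
    (hT₀ : T₀ < n ^ b) (ht : t T₀ ≠ 0) :
    3 * ((Fintype.piFinset fun _ : Fin (b * n) =>
      (Finset.range (2 ^ m)).map Nat.castEmbedding).filter fun f : Fin (b * n) → ℤ =>
        form n b t (fun i => if h : i < b * n then f ⟨i, h⟩ else 0) = 0).card ≤
      (2 ^ m) ^ (b * n) := by
  classical
  let x : ℕ → MvPolynomial (Fin (b * n)) ℤ := fun i => if h : i < b * n then X ⟨i, h⟩ else 0
  let p : MvPolynomial (Fin (b * n)) ℤ :=
    ∑ T ∈ Finset.range (n ^ b), C (t T) * ∏ j ∈ Finset.range b, x (j * n + dig n T j)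
  have heval : ∀ f : Fin (b * n) → ℤ,
      eval f p = form n b t (fun i => if h : i < b * n then f ⟨i, h⟩ else 0) := by
    intro f
    simp only [p, form, map_sum, map_mul, map_prod, eval_C]
    refine Finset.sum_congr rfl fun T _ => congrArg _ (Finset.prod_congr rfl fun j _ => ?_)
    simp only [x]
    split_ifs <;> simp
  have hp : p ≠ 0 := by
    intro h0
    -- At the point where variable `j * n + v` is `1` if `v` is digit `j` of `T₀` and `0` otherwise,
    -- only the monomial of `T₀` survives; its coefficient is nonzero.
    have h1 := heval fun i => if (i : ℕ) % n = dig n T₀ (i / n) then 1 else 0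
    rw [h0, map_zero, form, Finset.sum_eq_single T₀] at h1
    · rw [Finset.prod_eq_one] at h1
      · exact ht (by simpa using h1.symm)
      · intro j hj
        rw [Finset.mem_range] at hj
        have h2 := dig_lt hn T₀ j
        rw [dif_pos (idx_lt hj h2)]
        simp only
        rw [idx_mod h2, idx_div h2, if_pos rfl]
    · intro T hT hne
      rw [Finset.mem_range] at hT
      obtain ⟨j, hj, hd⟩ : ∃ j < b, dig n T j ≠ dig n T₀ j := by
        by_contra! hcon
        apply hne
        have := mod_pow_eq_of_dig hcon
        rwa [Nat.mod_eq_of_lt hT, Nat.mod_eq_of_lt hT₀] at this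
      rw [Finset.prod_eq_zero (Finset.mem_range.2 hj), mul_zero]
      have h2 := dig_lt hn T j
      rw [dif_pos (idx_lt hj h2)]
      simp only
      rw [idx_mod h2, idx_div h2, if_neg hd]
    · exact fun h => absurd (Finset.mem_range.2 hT₀) h
  have hdeg : p.totalDegree ≤ b := by
    refine totalDegree_finsetSum_le fun T _ => (totalDegree_mul _ _).trans ?_
    rw [totalDegree_C, zero_add]
    refine (totalDegree_finsetProd _ _).trans ?_
    refine (Finset.sum_le_card_nsmul _ _ 1 fun j _ => ?_).trans (by simp)
    simp only [x]
    split_ifs <;> simp [totalDegree_X]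
  have key := schwartz_zippel_totalDegree hp ((Finset.range (2 ^ m)).map Nat.castEmbedding)
  simp only [heval, Finset.card_map, Finset.card_range] at key
  rw [div_le_div_iff₀ (by positivity) (by positivity)] at key
  norm_cast at key
  have h1 := key.trans (Nat.mul_le_mul_right _ hdeg)
  have h2 : 0 < 2 ^ m := by positivity
  refine Nat.le_of_mul_le_mul_right (c := 2 ^ m) ?_ h2
  calc _ ≤ 3 * (b * (2 ^ m) ^ (b * n)) := by rw [mul_assoc]; exact Nat.mul_le_mul_left 3 h1
    _ = (3 * b) * (2 ^ m) ^ (b * n) := by ring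
    _ ≤ 2 ^ m * (2 ^ m) ^ (b * n) := Nat.mul_le_mul_right _ hm
    _ = _ := mul_comm _ _

/-- The probability of an event that is determined by the first `D` coins. -/
theorem fairCoins_eq_card (D : ℕ) (S : Finset (Finset.range D → Bool)) :
    RAM.fairCoins {c | (Finset.range D).restrict (π := fun _ => Bool) c ∈ S} = S.card * (2⁻¹ : ENNReal) ^ D := by
  have h1 : {c : ℕ → Bool | (Finset.range D).restrict (π := fun _ => Bool) c ∈ S} =
      (Finset.range D).restrict ⁻¹' (S : Set (Finset.range D → Bool)) := rfl
  rw [h1, ← Measure.map_apply (Finset.measurable_restrict _) S.measurableSet, RAM.fairCoins,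
    Measure.infinitePi_map_restrict, ← sum_measure_singleton]
  simp [Measure.pi_singleton]

/-- The event depends on the first `b * n * m` coins only. Cutting them into blocks of `m` bits maps
them injectively into the cube of `card_form_eq_zero_le`, which has as many points as there are
outcomes. -/
theorem fairCoins_form_le {n b m : ℕ} (hn : 0 < n) (hm : 3 * b ≤ 2 ^ m) {t : ℕ → ℤ} {T₀ : ℕ}
    (hT₀ : T₀ < n ^ b) (ht : t T₀ ≠ 0) :
    RAM.fairCoins {c | form n b t (fun i => coinVal m c i) = 0} ≤ 1 / 3 := by
  classical
  set D := b * n * m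
  let e : (Finset.range D → Bool) → ℕ → Bool := fun x i =>
    if h : i ∈ Finset.range D then x ⟨i, h⟩ else false
  have hidx : ∀ i < b * n, ∀ l < m, i * m + l < D := fun i hi l hl => idx_lt hi hl
  have he : ∀ c : ℕ → Bool, ∀ i < b * n,
      coinVal m (e ((Finset.range D).restrict (π := fun _ => Bool) c)) i = coinVal m c i := by
    intro c i hi
    unfold coinVal bitsVal
    refine Finset.sum_congr rfl fun l hl => ?_
    simp only [e, Finset.restrict]
    rw [dif_pos (Finset.mem_range.2 (hidx i hi l (Finset.mem_range.1 hl)))]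
  have hform : ∀ u u' : ℕ → ℤ, (∀ i < b * n, u i = u' i) → form n b t u = form n b t u' := by
    intro u u' h
    refine Finset.sum_congr rfl fun T _ => congrArg _ (Finset.prod_congr rfl fun j hj => ?_)
    exact h _ (idx_lt (Finset.mem_range.1 hj) (dig_lt hn _ _))
  let S : Finset (Finset.range D → Bool) :=
    Finset.univ.filter fun x => form n b t (fun i => coinVal m (e x) i) = 0
  have hS : {c | form n b t (fun i => coinVal m c i) = 0} =
      {c | (Finset.range D).restrict (π := fun _ => Bool) c ∈ S} := by
    ext c
    simp only [Set.mem_ofPred_eq, S, Finset.mem_filter, Finset.mem_univ, true_and]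
    rw [hform _ (fun i => (coinVal m (e ((Finset.range D).restrict (π := fun _ => Bool) c)) i : ℤ))
      fun i hi => by rw [he c i hi]]
  have hcard : 3 * S.card ≤ 2 ^ D := by
    refine le_trans (Nat.mul_le_mul_left 3 (Finset.card_le_card_of_injOn
      (fun x (i : Fin (b * n)) => (coinVal m (e x) i : ℤ)) ?_ ?_))
      ((card_form_eq_zero_le hn hm hT₀ ht).trans (by rw [← pow_mul, mul_comm m]))
    · intro x hx
      simp only [S, Finset.coe_filter, Finset.mem_univ, true_and, Set.mem_ofPred_eq] at hx
      simp only [Finset.coe_filter, Set.mem_ofPred_eq, Fintype.mem_piFinset, Finset.mem_map,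
        Finset.mem_range]
      refine ⟨fun i => ⟨_, bitsVal_lt _ _, rfl⟩, ?_⟩
      rw [← hx]
      exact hform _ _ fun i hi => by rw [dif_pos hi]
    · intro x _ y _ hxy
      ext ⟨q, hq⟩
      have hq' := Finset.mem_range.1 hq
      have hm0 : 0 < m := by
        rcases Nat.eq_zero_or_pos m with h | h
        · simp [D, h] at hq'
        · exact h
      have h1 := congrFun hxy ⟨q / m, (Nat.div_lt_iff_lt_mul hm0).2 hq'⟩
      have h2 := bitsVal_inj (Nat.cast_injective h1) (q % m) (Nat.mod_lt _ hm0)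
      simp only [Nat.div_add_mod', e, dif_pos hq] at h2
      exact h2
  rw [hS, fairCoins_eq_card, ← ENNReal.inv_pow, ← div_eq_mul_inv, ENNReal.div_le_iff (by simp) (by simp),
    one_div, mul_comm, ← div_eq_mul_inv, ENNReal.le_div_iff_mul_le (by simp) (by simp), mul_comm]
  exact_mod_cast hcard

end CliqueCode

/-! ### The expressions of the protocol -/

namespace CliqueCode

open RAM

variable {E : Env} {L : ℕ} {Γ Γ' : Ctx} {k n : ℕ}

/-- Register `0` holds `n`, and numbers that are polynomial in `n` have at most `L` bits. -/
structure Setup (E : Env) (L : ℕ) (Γ : Ctx) (k n : ℕ) : Prop where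
  reg : Has E L Γ (regE 0) n 1 1
  pow_lt : ∀ e ≤ (k + 10) ^ 2, (n + 2) ^ e < 2 ^ L

theorem Setup.lift (h : Setup E L Γ k n) (hΓ : Γ ≤ Γ') : Setup E L Γ' k n :=
  ⟨h.reg.lift hΓ, h.pow_lt⟩

theorem Setup.lt (h : Setup E L Γ k n) {v e : ℕ} (hv : v ≤ (n + 2) ^ e) (he : e ≤ (k + 10) ^ 2) :
    v < 2 ^ L := hv.trans_lt (h.pow_lt e he)

theorem Setup.one_le (h : Setup E L Γ k n) : 1 ≤ L := by
  rcases Nat.eq_zero_or_pos L with rfl | hL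
  · have := h.pow_lt 0 (by positivity)
    simp at this
  · exact hL

/-- Most exponents are linear in `k`; the square in `Setup` is needed for products of `k / 2` random
numbers of `k + 2` bits. -/
theorem le_sq_of_le {k c : ℕ} (hc : c ≤ 20 * k + 100) : c ≤ (k + 10) ^ 2 := by nlinarith

/-! Polynomial bounds -/

theorem pb_mono {n v e f : ℕ} (h : v ≤ (n + 2) ^ e) (hf : e ≤ f) : v ≤ (n + 2) ^ f :=
  h.trans (Nat.pow_le_pow_right (by omega) hf)

theorem pb_mul {n v w e f : ℕ} (h : v ≤ (n + 2) ^ e) (h' : w ≤ (n + 2) ^ f) :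
    v * w ≤ (n + 2) ^ (e + f) := by
  rw [pow_add]
  exact Nat.mul_le_mul h h'

theorem pb_add {n v w e f : ℕ} (h : v ≤ (n + 2) ^ e) (h' : w ≤ (n + 2) ^ f) :
    v + w ≤ (n + 2) ^ (e + f + 1) := by
  have h1 : v ≤ (n + 2) ^ (e + f) := pb_mono h (by omega)
  have h2 : w ≤ (n + 2) ^ (e + f) := pb_mono h' (by omega)
  calc v + w ≤ (n + 2) ^ (e + f) * 2 := by omega
    _ ≤ (n + 2) ^ (e + f) * (n + 2) := Nat.mul_le_mul_left _ (by omega)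
    _ = _ := (pow_succ _ _).symm

theorem pb_two_pow (n i : ℕ) : 2 ^ i ≤ (n + 2) ^ i := Nat.pow_le_pow_left (by omega) i

theorem pb_const (n c : ℕ) : c ≤ (n + 2) ^ c := Nat.lt_two_pow_self.le.trans (pb_two_pow n c)

theorem pb_pow (n i : ℕ) : n ^ i ≤ (n + 2) ^ i := Nat.pow_le_pow_left (by omega) i

theorem pb_self (n : ℕ) : n ≤ (n + 2) ^ 1 := by rw [pow_one]; omega

theorem Setup.const_lt (h : Setup E L Γ k n) {c : ℕ} (hc : c ≤ (k + 10) ^ 2) : c < 2 ^ L :=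
  h.lt (pb_const n c) hc

/-! Digits and the relation -/

/-- Digit number `i` of `Z` in base `n`. -/
def digE (Z i : Ex) : Ex := modE (divE Z (powE (regE 0) i)) (regE 0)

theorem has_dig (hs : Setup E L Γ k n) {Z I : Ex} {z i N h : ℕ} (hZ : Has E L Γ Z z 1 1)
    (hI : Has E L Γ I i N h) (hi : i ≤ k) :
    Has E L Γ (digE Z I) (dig n z i) (N + 7 * k + 8) (h + 16) := by
  refine ((hZ.div (hs.reg.pow hI fun j hj => hs.lt (pb_pow n j) (le_sq_of_le (by omega)))).mod hs.reg).mono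
    (by omega) (by omega)

/-- `1` if `u` and `v` are adjacent and `u < v`, otherwise `0`. -/
def relE (u v : Ex) : Ex := letE u fun U => letE v fun V =>
  mulE (ltE U V) (bitE .input (addE (mulE U (regE 0)) V))

/-- The bounds on `u` and `v` are conditional because the time bounds also concern the empty graph,
where digits in base `0` need not be below `n`. -/
theorem has_rel (hs : Setup E L Γ k n) {x y : Ex} {u v N N' h h' : ℕ} (hx : Has E L Γ x u N h)
    (hy : Has E L Γ y v N' h') (hu : 0 < n → u < n) (hv : 0 < n → v < n) :
    Has E L Γ (relE x y) (rel n E.input u v) (N + N' + 14) (h + h' + 18) := by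
  have hlt : u * n + v < 2 ^ L := by
    rcases Nat.eq_zero_or_pos n with h0 | h0
    · rw [h0, mul_zero, zero_add]
      exact hy.1
    · exact hs.lt ((idx_lt (hu h0) (hv h0)).le.trans (pb_mul (pb_self n) (pb_self n))) (le_sq_of_le (by omega))
  refine (hx.letE (N' := N' + 13) (h' := h' + 16) fun Γ₁ U h1 hU =>
    ((hy.lift h1).letE (N' := 12) (h' := 14) fun Γ₂ V h2 hV => ?_).mono (by omega) (by omega)).mono
      (by omega) (by omega)
  have hU' := hU.lift h2
  have h3 := hU'.lt hV hs.one_le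
  refine (h3.mul (((hU'.mul (hs.reg.lift (Ctx.le_trans h1 h2)) ?_).add hV hlt).bit hs.one_le) ?_).mono
    (by omega) (by omega)
  · omega
  · exact (rel_le_one n E.input u v).trans_lt (hs.const_lt (le_sq_of_le (by omega)))

theorem dig_lt' {n : ℕ} (Z i : ℕ) (hn : 0 < n) : dig n Z i < n := dig_lt hn Z i

/-- `1` if the `l` lowest digits of `Z` form a clique and are in order, otherwise `0`. -/
def chainE (Z : Ex) (l : ℕ) : Ex := prodE (constE l) fun I => prodE I fun J =>
  relE (digE Z I) (digE Z J)

/-- Independent of `n`: testing one tuple takes a number of instructions that depends on `k` only.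
-/
def chainCost (k : ℕ) : ℕ := 5 + k * (k * (14 * k + 38) + 11)

theorem has_chain (hs : Setup E L Γ k n) {Z : Ex} {z l : ℕ} (hZ : Has E L Γ Z z 1 1) (hl : l ≤ k) :
    Has E L Γ (chainE Z l) (chain n (rel n E.input) z l) (chainCost k) 72 := by
  have h1 := hs.const_lt (c := 1) (le_sq_of_le (by omega))
  refine ((Has.const (hs.const_lt (le_sq_of_le (by omega)))).prod (Nb := k * (14 * k + 38) + 5) (hb := 62)
    (fun i _ => (prod_le_one_of fun _ _ => prod_le_one_of fun _ _ => rel_le_one _ _ _ _).trans_lt h1)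
    fun i hi Γ₁ I hΓ₁ hI => ?_).mono ?_ (by omega)
  · refine (hI.prod (Nb := 14 * k + 32) (hb := 52)
      (fun j _ => (prod_le_one_of fun _ _ => rel_le_one _ _ _ _).trans_lt h1)
      fun j hj Γ₂ J hΓ₂ hJ => ?_).mono ?_ (by omega)
    · have hs₂ := hs.lift (Ctx.le_trans hΓ₁ hΓ₂)
      have hZ₂ := hZ.lift (Ctx.le_trans hΓ₁ hΓ₂)
      exact (has_rel hs₂ (has_dig hs₂ hZ₂ (hI.lift hΓ₂) (by omega))
        (has_dig hs₂ hZ₂ hJ (by omega)) (dig_lt' z i) (dig_lt' z j)).mono (by omega) (by omega)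
    · have := Nat.mul_le_mul_right (14 * k + 38) (hi.le.trans hl)
      linarith
  · have := Nat.mul_le_mul_right (k * (14 * k + 38) + 11) hl
    unfold chainCost
    linarith

/-- `1` if all of the `a` lowest digits of `X` are related to `v`, otherwise `0`. -/
def commonE (a : ℕ) (X v : Ex) : Ex := prodE (constE a) fun I => relE (digE X I) v

def commonCost (k N : ℕ) : ℕ := 5 + k * (7 * k + N + 29)

theorem has_common (hs : Setup E L Γ k n) {X V : Ex} {x v a N h : ℕ} (hX : Has E L Γ X x 1 1)
    (hV : Has E L Γ V v N h) (hv : 0 < n → v < n) (ha : a ≤ k) :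
    Has E L Γ (commonE a X V) (common n (rel n E.input) a x v) (commonCost k N) (h + 45) := by
  refine ((Has.const (hs.const_lt (le_sq_of_le (by omega)))).prod (Nb := 7 * k + N + 23) (hb := h + 35)
    (fun i _ => (prod_le_one_of fun _ _ => rel_le_one _ _ _ _).trans_lt
      (hs.const_lt (le_sq_of_le (by omega)))) fun i hi Γ₁ I hΓ₁ hI => ?_).mono ?_ (by omega)
  · have hs₁ := hs.lift hΓ₁
    exact (has_rel hs₁ (has_dig hs₁ (hX.lift hΓ₁) hI (by omega)) (hV.lift hΓ₁) (dig_lt' x i)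
      hv).mono (by omega) (by omega)
  · have := Nat.mul_le_mul_right (7 * k + N + 29) ha
    unfold commonCost
    linarith

/-! Numbers in the message, and random numbers -/

/-- The number whose `W` bits start at position `pos` of the message. -/
def numE (W pos : Ex) : Ex :=
  sumE W fun I => mulE (bitE .message (addE pos I)) (powE (constE 2) I)

def numCost (W : ℕ) : ℕ := 5 + W * (7 * W + 16)

/-- The number whose `W` bits start at position `pos` of `w`. -/
def num (w : List Bool) (W pos : ℕ) : ℕ := bitsVal W fun l => w.getD (pos + l) false

theorem has_num (hs : Setup E L Γ k n) {W P : Ex} {wv p : ℕ} (hW : Has E L Γ W wv 1 1)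
    (hP : Has E L Γ P p 1 1) (hp : p + wv < 2 ^ L) (hw : 2 ^ wv < 2 ^ L) :
    Has E L Γ (numE W P) (num E.message wv p) (numCost wv) 28 := by
  have h2 := hs.const_lt (c := 2) (le_sq_of_le (by omega))
  have hpow : ∀ i ≤ wv, 2 ^ i < 2 ^ L := fun i hi =>
    (Nat.pow_le_pow_right two_pos hi).trans_lt hw
  refine (hW.sum (Nb := 7 * wv + 10) (hb := 18)
    (f := fun l => (E.message.getD (p + l) false).toNat * 2 ^ l)
    ((bitsVal_lt wv fun l => E.message.getD (p + l) false).trans hw)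
    fun i hi Γ₁ I hΓ₁ hI => ?_).mono ?_ (by omega)
  · refine ((((hP.lift hΓ₁).add hI (by omega)).bit (t := .message) hs.one_le).mul
      ((Has.const h2).pow hI fun j hj => hpow j (by omega)) ?_).mono (by omega) (by omega)
    have h3 := Bool.toNat_le (E.message.getD (p + i) false)
    exact (Nat.mul_le_mul_right (2 ^ i) h3).trans_lt (by simpa using hpow i hi.le)
  · unfold numCost
    linarith

/-- The `i`-th random number, composed of `m` coins in the table. -/
def coinE (m : ℕ) (i : Ex) : Ex := sumE (constE m) fun l =>
  mulE (cellE (addE (mulE (constE 2) (addE (mulE i (constE m)) l)) (constE 1)))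
    (powE (constE 2) l)

def coinCost (m : ℕ) : ℕ := 5 + m * (7 * m + 22)

theorem has_coin (hs : Setup E L Γ k n) {m i N : ℕ} {I : Ex} (hm : m ≤ k + 2) (hi : i < N)
    (htab : ∀ q < N * m, Γ.m (2 * q + 1) = (E.coins q).toNat) (hN : 2 * (N * m) < 2 ^ L)
    (hI : Has E L Γ I i 1 1) : Has E L Γ (coinE m I) (coinVal m E.coins i) (coinCost m) 37 := by
  have h2 := hs.const_lt (c := 2) (le_sq_of_le (by omega))
  have hpow : ∀ j ≤ m, 2 ^ j < 2 ^ L := fun j hj => hs.lt (pb_two_pow n j) (le_sq_of_le (by omega))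
  have hmL := hs.const_lt (c := m) (le_sq_of_le (by omega))
  refine ((Has.const hmL).sum (Nb := 7 * m + 16) (hb := 27)
    (f := fun l => (E.coins (i * m + l)).toNat * 2 ^ l)
    ((bitsVal_lt m fun l => E.coins (i * m + l)).trans (hpow m le_rfl))
    fun l hl Γ₁ J hΓ₁ hJ => ?_).mono ?_ (by omega)
  · have hlt := idx_lt hi hl
    have h3 := Bool.toNat_le (E.coins (i * m + l))
    have haddr := (((Has.const h2).mul (((hI.lift hΓ₁).mul (Has.const hmL) (by omega)).add hJ
      (by omega)) (by omega)).add (Has.const (v := 1) (by omega)) (by omega))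
    refine ((haddr.cell (w := (E.coins (i * m + l)).toNat) (by omega) ?_ (by omega)).mul
      ((Has.const h2).pow hJ fun j hj => hpow j (by omega)) ?_).mono (by omega) (by omega)
    · rw [hΓ₁.2 _ (.inl (by omega)), htab _ hlt]
    · exact (Nat.mul_le_mul_right (2 ^ l) h3).trans_lt (by simpa using hpow l hl.le)
  · unfold coinCost
    linarith

end CliqueCode

/-! ### The verifier -/

namespace CliqueCode

open RAM

variable {E : Env} {L : ℕ} {Γ Γ' : Ctx} {k n : ℕ}

/-- Bit length of the numbers in the message. -/
def wid (k n : ℕ) : ℕ := (n ^ (k - k / 2)).size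

/-- The first number in the message: the claimed first part of the solution. -/
def head (k n : ℕ) (w : List Bool) : ℕ := num w (wid k n) 0

/-- The other numbers in the message: the claimed values of `count`. -/
def table (k n : ℕ) (w : List Bool) (T : ℕ) : ℕ := num w (wid k n) (wid k n + T * wid k n)

/-- Limits every number read from the message, honest or not; in particular the loop over `X < head`
is short even if the claimed head is out of range. -/
theorem two_pow_wid_le (k n : ℕ) : 2 ^ wid k n ≤ 2 * n ^ (k - k / 2) + 1 := by
  unfold wid
  generalize n ^ (k - k / 2) = A
  rcases Nat.eq_zero_or_pos A.size with h | h
  · simp [h]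
  · have h1 : 2 ^ (A.size - 1) ≤ A := by
      rw [← Nat.lt_size]
      omega
    have h2 : 2 ^ A.size = 2 * 2 ^ (A.size - 1) := by rw [← pow_succ']; congr 1; omega
    omega

theorem pb_two_pow_wid (k n : ℕ) : 2 ^ wid k n ≤ (n + 2) ^ (k + 2) := by
  refine (two_pow_wid_le k n).trans (pb_mono (pb_add (f := 0) (pb_mul (e := 1) (by rw [pow_one]; omega)
    (pb_pow n _)) (by simp)) (by omega))

theorem pb_wid (k n : ℕ) : wid k n ≤ (n + 2) ^ (k + 2) :=
  Nat.lt_two_pow_self.le.trans (pb_two_pow_wid k n)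

/-- The registers `1`, `2`, `3` hold `n ^ (k - k / 2)`, `n ^ (k / 2)`, and the bit length of the
former. -/
structure Setup3 (E : Env) (L : ℕ) (Γ : Ctx) (k n : ℕ) : Prop extends Setup E L Γ k n where
  reg1 : Has E L Γ (regE 1) (n ^ (k - k / 2)) 1 1
  reg2 : Has E L Γ (regE 2) (n ^ (k / 2)) 1 1
  reg3 : Has E L Γ (regE 3) (wid k n) 1 1

theorem Setup3.lift (h : Setup3 E L Γ k n) (hΓ : Γ ≤ Γ') : Setup3 E L Γ' k n :=
  ⟨h.toSetup.lift hΓ, h.reg1.lift hΓ, h.reg2.lift hΓ, h.reg3.lift hΓ⟩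

/-- The coins are stored in the table. -/
def Coins (E : Env) (Γ : Ctx) (N : ℕ) : Prop := ∀ q < N, Γ.m (2 * q + 1) = (E.coins q).toNat

theorem Coins.lift {N : ℕ} (h : Coins E Γ N) (hΓ : Γ ≤ Γ') : Coins E Γ' N := fun q hq => by
  rw [hΓ.2 _ (.inl (by omega)), h q hq]

theorem idx_add_lt (hs : Setup E L Γ k n) {i : ℕ} (hi : i ≤ k * n) : 2 * (i * (k + 2)) < 2 ^ L := by
  refine hs.lt (pb_mul (e := 1) (by rw [pow_one]; omega)
    (pb_mul (hi.trans (pb_mul (pb_const n k) (pb_self n))) (pb_const n (k + 2)))) (by nlinarith)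

theorem has_coin' (hs : Setup E L Γ k n) {i j v N h : ℕ} {I : Ex} (hj : j < k / 2) (hv : v < n)
    (hc : Coins E Γ (k / 2 * n * (k + 2))) (hI : Has E L Γ I i N h) (hi : i = j * n + v) :
    Has E L Γ (letE I (coinE (k + 2))) (coinVal (k + 2) E.coins (j * n + v))
      (N + coinCost (k + 2) + 1) (h + 39) := by
  subst hi
  refine hI.letE fun Γ₁ X hΓ hX => ?_
  exact has_coin (hs.lift hΓ) le_rfl (idx_lt hj hv) (hc.lift hΓ)
    (idx_add_lt hs (Nat.mul_le_mul_right n (Nat.div_le_self k 2))) hX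

theorem idx_lt' (hs : Setup E L Γ k n) {j v : ℕ} (hj : j < k / 2) (hv : v < n) :
    j * n + v < 2 ^ L := by
  have h1 := idx_lt hj hv
  have h2 : k / 2 * n ≤ k * n := Nat.mul_le_mul_right n (Nat.div_le_self k 2)
  have h3 := idx_add_lt hs h2
  have h4 := Nat.le_mul_of_pos_right (k / 2 * n) (show 0 < k + 2 by omega)
  omega

theorem pos_of_lt_pow {n b T : ℕ} (hb : 0 < b) (hT : T < n ^ b) : 0 < n := by
  rcases Nat.eq_zero_or_pos n with rfl | h
  · rw [zero_pow hb.ne'] at hT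
    omega
  · exact h

/-- The random weight of `T`. -/
def weightE (k : ℕ) (T : Ex) : Ex := prodE (constE (k / 2)) fun J =>
  letE (addE (mulE J (regE 0)) (digE T J)) (coinE (k + 2))

/-- The monomial of `T` at the random point. -/
def weight (k n : ℕ) (c : ℕ → Bool) (T : ℕ) : ℕ :=
  ∏ j ∈ Finset.range (k / 2), coinVal (k + 2) c (j * n + dig n T j)

def weightCost (k : ℕ) : ℕ := 5 + k * (7 * k + coinCost (k + 2) + 20)

theorem coinVal_le (k n : ℕ) (c : ℕ → Bool) (i : ℕ) :
    coinVal (k + 2) c i ≤ (n + 2) ^ (k + 2) :=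
  (bitsVal_lt _ _).le.trans (pb_two_pow n _)

theorem weight_le (k n : ℕ) (c : ℕ → Bool) (T i : ℕ) :
    ∏ j ∈ Finset.range i, coinVal (k + 2) c (j * n + dig n T j) ≤ (n + 2) ^ ((k + 2) * i) := by
  refine (Finset.prod_le_prod' fun j _ => coinVal_le k n c (j * n + dig n T j)).trans ?_
  rw [Finset.prod_const, Finset.card_range, ← pow_mul]

theorem has_weight (hs : Setup E L Γ k n) {T : Ex} {t : ℕ} (ht : t < n ^ (k / 2))
    (hc : Coins E Γ (k / 2 * n * (k + 2))) (hT : Has E L Γ T t 1 1) :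
    Has E L Γ (weightE k T) (weight k n E.coins t) (weightCost k) 72 := by
  have hk := Nat.div_le_self k 2
  refine ((Has.const (hs.const_lt (le_sq_of_le (by omega)))).prod
    (Nb := 7 * k + coinCost (k + 2) + 14) (hb := 62)
    (fun i hi => hs.lt (weight_le k n E.coins t i) (by nlinarith)) fun j hj Γ₁ J hΓ₁ hJ => ?_).mono
    ?_ (by omega)
  · have hs₁ := hs.lift hΓ₁
    have hd := dig_lt (pos_of_lt_pow (by omega) ht) t j
    have hlt := idx_lt' hs hj hd
    exact (has_coin' hs₁ hj hd (hc.lift hΓ₁) ((hJ.mul hs₁.reg (by omega)).add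
      (has_dig hs₁ (hT.lift hΓ₁) hJ (by omega)) hlt) rfl).mono (by omega) (by omega)
  · have := Nat.mul_le_mul_right (7 * k + coinCost (k + 2) + 20) hk
    unfold weightCost
    linarith

/-- Entry `T` of the table in the message. -/
def tableE (T : Ex) : Ex := letE (addE (regE 3) (mulE T (regE 3))) fun P => numE (regE 3) P

theorem has_table (hs : Setup3 E L Γ k n) {T : Ex} {t : ℕ} (ht : t < n ^ (k / 2))
    (hT : Has E L Γ T t 1 1) :
    Has E L Γ (tableE T) (table k n E.message t) (numCost (wid k n) + 6) 37 := by
  have h1 := pb_wid k n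
  have h2 : t * wid k n ≤ (n + 2) ^ (k / 2 + (k + 2)) := pb_mul (ht.le.trans (pb_pow n _)) h1
  have h3 : wid k n + t * wid k n + wid k n < 2 ^ L :=
    hs.lt (pb_add (pb_add h1 h2) h1) (le_sq_of_le (by omega))
  refine ((hs.reg3.add (hT.mul hs.reg3 (by omega)) (by omega)).letE (N' := numCost (wid k n))
    (h' := 28) fun Γ₁ P hΓ hP => ?_).mono (by omega) (by omega)
  exact has_num (hs.toSetup.lift hΓ) (hs.reg3.lift hΓ) hP h3
    (hs.lt (pb_two_pow_wid k n) (le_sq_of_le (by omega)))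

theorem table_le (k n : ℕ) (w : List Bool) (T : ℕ) : table k n w T ≤ (n + 2) ^ (k + 2) :=
  (bitsVal_lt _ _).le.trans (pb_two_pow_wid k n)

theorem head_le (k n : ℕ) (w : List Bool) : head k n w ≤ (n + 2) ^ (k + 2) :=
  (bitsVal_lt _ _).le.trans (pb_two_pow_wid k n)

theorem pb_sum {n N e f : ℕ} {g : ℕ → ℕ} (hN : N ≤ (n + 2) ^ e) (hg : ∀ i < N, g i ≤ (n + 2) ^ f) :
    ∑ i ∈ Finset.range N, g i ≤ (n + 2) ^ (e + f) := by
  refine (Finset.sum_le_card_nsmul _ _ _ fun i hi => hg i (Finset.mem_range.1 hi)).trans ?_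
  rw [Finset.card_range, smul_eq_mul]
  exact pb_mul hN le_rfl

/-- The claimed value of the random form. -/
def leftE (k : ℕ) : Ex := sumE (regE 2) fun T => mulE (tableE T) (weightE k T)

def left (k n : ℕ) (w : List Bool) (c : ℕ → Bool) : ℕ :=
  ∑ T ∈ Finset.range (n ^ (k / 2)), table k n w T * weight k n c T

theorem has_left (hs : Setup3 E L Γ k n) (hc : Coins E Γ (k / 2 * n * (k + 2))) :
    Has E L Γ (leftE k) (left k n E.message E.coins)
      (5 + n ^ (k / 2) * (numCost (wid k n) + weightCost k + 13)) 121 := by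
  have hpb : ∀ T < n ^ (k / 2), table k n E.message T * weight k n E.coins T ≤
      (n + 2) ^ (k + 2 + (k + 2) * (k / 2)) := fun T _ =>
    pb_mul (table_le k n E.message T) (weight_le k n E.coins T _)
  have hk : (k + 2) * (k / 2) ≤ (k + 2) * k := Nat.mul_le_mul_left _ (Nat.div_le_self k 2)
  refine (hs.reg2.sum (Nb := numCost (wid k n) + weightCost k + 7) (hb := 111)
    (hs.lt (pb_sum (pb_pow n _) hpb) (by nlinarith [Nat.div_le_self k 2]))
    fun T hT Γ₁ I hΓ hI => ?_).mono ?_ (by omega)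
  · exact ((has_table (hs.lift hΓ) hT hI).mul (has_weight (hs.toSetup.lift hΓ) hT (hc.lift hΓ) hI)
      (hs.lt (hpb T hT) (by nlinarith))).mono (by omega) (by omega)
  · linarith

/-- The true value of the random form. -/
def rightE (k : ℕ) : Ex := sumE (regE 4) fun X => mulE (chainE X (k - k / 2))
  (prodE (constE (k / 2)) fun J => sumE (regE 0) fun V =>
    mulE (commonE (k - k / 2) X V) (letE (addE (mulE J (regE 0)) V) (coinE (k + 2))))

/-- The short side of `sum_count`, which avoids the sum over all tails. -/
def right (k n : ℕ) (M : List Bool) (x : ℕ) (c : ℕ → Bool) : ℕ :=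
  ∑ X ∈ Finset.range x, chain n (rel n M) X (k - k / 2) *
    ∏ j ∈ Finset.range (k / 2), ∑ v ∈ Finset.range n,
      common n (rel n M) (k - k / 2) X v * coinVal (k + 2) c (j * n + v)

/-- The first factor bounds the claimed head, and the inner `n` is the sum over `v`. The order `n ^
(k - k / 2 + 1)` dominates the verifier's time. -/
def rightCost (k n : ℕ) : ℕ :=
  5 + (2 * n ^ (k - k / 2) + 1) *
    (chainCost k + k * (n * (commonCost k 1 + coinCost (k + 2) + 13) + 11) + 12)

theorem has_right (hs : Setup3 E L Γ k n) (hc : Coins E Γ (k / 2 * n * (k + 2)))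
    (h4 : Has E L Γ (regE 4) (head k n E.message) 1 1) :
    Has E L Γ (rightE k) (right k n E.input (head k n E.message) E.coins) (rightCost k n) 198 := by
  have hk := Nat.div_le_self k 2
  have hone : ∀ X, chain n (rel n E.input) X (k - k / 2) ≤ (n + 2) ^ 0 := fun X =>
    chain_le_one (rel_le_one n E.input) X _
  have hterm : ∀ X v j, common n (rel n E.input) (k - k / 2) X v *
      coinVal (k + 2) E.coins (j * n + v) ≤ (n + 2) ^ (0 + (k + 2)) := fun X v j =>
    pb_mul (common_le_one (rel_le_one n E.input) _ X v) (coinVal_le k n _ _)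
  have hsum : ∀ X j, ∑ v ∈ Finset.range n, common n (rel n E.input) (k - k / 2) X v *
      coinVal (k + 2) E.coins (j * n + v) ≤ (n + 2) ^ (k + 3) := fun X j =>
    pb_mono (pb_sum (pb_self n) fun v _ => hterm X v j) (by omega)
  have hprod : ∀ X i, i ≤ k / 2 → ∏ j ∈ Finset.range i, ∑ v ∈ Finset.range n,
      common n (rel n E.input) (k - k / 2) X v *
      coinVal (k + 2) E.coins (j * n + v) ≤ (n + 2) ^ ((k + 3) * k) := by
    intro X i hi
    refine (Finset.prod_le_prod' fun j _ => hsum X j).trans ?_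
    rw [Finset.prod_const, Finset.card_range, ← pow_mul]
    exact Nat.pow_le_pow_right (by omega) (Nat.mul_le_mul_left _ (hi.trans hk))
  have hx : head k n E.message ≤ 2 * n ^ (k - k / 2) + 1 :=
    (bitsVal_lt _ _).le.trans (two_pow_wid_le k n)
  refine (h4.sum (Nb := chainCost k + k * (n * (commonCost k 1 + coinCost (k + 2) + 13) + 11) + 6)
    (hb := 188) (hs.lt (pb_sum (head_le k n E.message) fun X _ =>
      pb_mul (hone X) (hprod X _ le_rfl)) (by nlinarith)) fun X hX Γ₁ I hΓ₁ hI => ?_).mono ?_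
    (by omega)
  · have hs₁ := hs.toSetup.lift hΓ₁
    refine ((has_chain hs₁ hI (by omega)).mul (N' := 5 + k * (n * (commonCost k 1 +
      coinCost (k + 2) + 13) + 11)) (h' := 114) (((Has.const (hs.const_lt
      (le_sq_of_le (by omega)))).prod (Nb := n * (commonCost k 1 +
      coinCost (k + 2) + 13) + 5) (hb := 104) (fun i hi => hs.lt (hprod X i hi) (by nlinarith))
      fun j hj Γ₂ J hΓ₂ hJ => ?_).mono ?_ (by omega)) (hs.lt (pb_mul (hone X) (hprod X _ le_rfl))
      (by nlinarith))).mono (by omega) (by omega)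
    · have hs₂ := hs₁.lift hΓ₂
      refine (hs₂.reg.sum (Nb := commonCost k 1 + coinCost (k + 2) + 7) (hb := 94)
        (hs.lt (hsum X j) (le_sq_of_le (by omega))) fun v hv Γ₃ V hΓ₃ hV => ?_).mono ?_ (by omega)
      · have hs₃ := hs₂.lift hΓ₃
        have hlt := idx_lt' hs.toSetup hj hv
        exact ((has_common hs₃ (hI.lift (Ctx.le_trans hΓ₂ hΓ₃)) hV (fun _ => hv) (by omega)).mul
          (has_coin' hs₃ hj hv (((hc.lift hΓ₁).lift hΓ₂).lift hΓ₃)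
            (((hJ.lift hΓ₃).mul hs₃.reg (by omega)).add hV hlt) rfl)
          (hs.lt (hterm X v j) (le_sq_of_le (by omega)))).mono (by omega) (by omega)
      · linarith
    · have := Nat.mul_le_mul_right (n * (commonCost k 1 + coinCost (k + 2) + 13) + 11) hk
      linarith
  · have := Nat.mul_le_mul_right (chainCost k + k * (n * (commonCost k 1 + coinCost (k + 2) + 13) +
      11) + 12) hx
    unfold rightCost
    linarith

/-- Not zero if the table contradicts the claim that no smaller clique exists. -/
def badE (k : ℕ) : Ex := sumE (regE 2) fun T => mulE (chainE T (k / 2)) (tableE T)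

def bad (k n : ℕ) (M w : List Bool) : ℕ :=
  ∑ T ∈ Finset.range (n ^ (k / 2)), chain n (rel n M) T (k / 2) * table k n w T

theorem has_bad (hs : Setup3 E L Γ k n) :
    Has E L Γ (badE k) (bad k n E.input E.message)
      (5 + n ^ (k / 2) * (chainCost k + numCost (wid k n) + 13)) 121 := by
  have hpb : ∀ T < n ^ (k / 2), chain n (rel n E.input) T (k / 2) * table k n E.message T ≤
      (n + 2) ^ (0 + (k + 2)) := fun T _ =>
    pb_mul (chain_le_one (rel_le_one n E.input) T _) (table_le k n E.message T)
  have hk := Nat.div_le_self k 2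
  refine (hs.reg2.sum (Nb := chainCost k + numCost (wid k n) + 7) (hb := 111)
    (hs.lt (pb_sum (pb_pow n _) hpb) (le_sq_of_le (by omega)))
    fun T hT Γ₁ I hΓ hI => ?_).mono ?_ (by omega)
  · exact ((has_chain (hs.toSetup.lift hΓ) hI hk).mul (has_table (hs.lift hΓ) hT hI)
      (hs.lt (hpb T hT) (le_sq_of_le (by omega)))).mono (by omega) (by omega)
  · linarith

/-- The second part of the solution. -/
def tailE (k : ℕ) : Ex := firstE (regE 2) fun T =>
  letE (addE (mulE (regE 4) (regE 2)) T) fun Z => chainE Z k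

/-- The tail is searched for rather than sent, so a dishonest prover cannot choose among cliques
with the same head. -/
def tail (k n : ℕ) (M : List Bool) (x : ℕ) : ℕ :=
  firstOne (fun T => chain n (rel n M) (x * n ^ (k / 2) + T) k) (n ^ (k / 2))

theorem pb_code (k n : ℕ) (w : List Bool) {T : ℕ} (hT : T ≤ n ^ (k / 2)) :
    head k n w * n ^ (k / 2) + T ≤ (n + 2) ^ (k + 2 + k / 2 + k / 2 + 1) :=
  pb_add (pb_mul (head_le k n w) (pb_pow n _)) (hT.trans (pb_pow n _))

theorem has_tail (hs : Setup3 E L Γ k n) (h4 : Has E L Γ (regE 4) (head k n E.message) 1 1) :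
    Has E L Γ (tailE k) (tail k n E.input (head k n E.message))
      (5 + n ^ (k / 2) * (chainCost k + 22)) 112 := by
  have hk := Nat.div_le_self k 2
  refine (hs.reg2.first (Nb := chainCost k + 6) (hb := 81) hs.one_le
    (fun T _ => chain_le_one (rel_le_one n E.input) _ _) fun T hT Γ₁ I hΓ hI => ?_).mono ?_
    (by omega)
  · have hlt := hs.lt (pb_code k n E.message hT.le) (le_sq_of_le (by omega))
    refine (((((h4.lift hΓ).mul (hs.reg2.lift hΓ) (by omega)).add hI hlt).letE (N' := chainCost k)
      (h' := 72) fun Γ₂ Z hΓ₂ hZ => ?_)).mono (by omega) (by omega)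
    exact has_chain (hs.toSetup.lift (Ctx.le_trans hΓ hΓ₂)) hZ le_rfl
  · linarith

/-- Not zero if the verifier accepts. -/
def okE : Ex := mulE (mulE (ltE (regE 4) (regE 1)) (ltE (regE 8) (regE 2)))
  (mulE (ltE (regE 7) (constE 1))
    (mulE (subE (constE 1) (ltE (regE 5) (regE 6))) (subE (constE 1) (ltE (regE 6) (regE 5)))))

/-- Compute `x` into the first unknown register. -/
theorem assign {x : Ex} {D v N h : ℕ} {m : ℕ → ℕ} (hx : Has E L ⟨D, m⟩ x v N h)
    (hL : 2 * (D + h) < 2 ^ L) (f : ℕ) (l : List ℕ) : ∃ m', Runs E L (x D) ⟨m, f, l⟩ ⟨m', f, l⟩ N ∧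
      (⟨D, m⟩ : Ctx) ≤ ⟨D + 1, m'⟩ ∧ Has E L ⟨D + 1, m'⟩ (regE D) v 1 1 ∧ m' (2 * D) = v := by
  obtain ⟨m', h1, h2, h3⟩ := hx.2 D m f l le_rfl hL (Agree.refl _ _)
  exact ⟨m', h1, ⟨by simp, h3⟩, .reg (by simp) h2 hx.1, h2⟩

theorem has_mul_one {x y : Ex} {v w N N' h h' : ℕ} (hL : 1 ≤ L) (hx : Has E L Γ x v N h)
    (hy : Has E L Γ y w N' h') (hv : v ≤ 1) (hw : w ≤ 1) :
    Has E L Γ (mulE x y) (v * w) (N + N' + 1) (h + h' + 2) :=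
  hx.mul hy ((Nat.mul_le_mul hv hw).trans_lt (Nat.one_lt_two_pow (by omega)))

theorem ite_le_one (p : Prop) [Decidable p] : (if p then 1 else 0) ≤ 1 := by
  split_ifs <;> omega

/-- The verifier. -/
def verifierCode (k : ℕ) : Code :=
  .seq (powE (regE 0) (constE (k - k / 2)) 1) <| .seq (powE (regE 0) (constE (k / 2)) 2) <|
  .seq (sizeE (regE 1) 3) <| .seq (numE (regE 3) (constE 0) 4) <|
  .seq (coinLoop (mulE (mulE (constE (k / 2)) (regE 0)) (constE (k + 2))) 5) <|
  .seq (leftE k 5) <| .seq (rightE k 6) <| .seq (badE k 7) <| .seq (tailE k 8) <|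
  .seq (addE (mulE (regE 4) (regE 2)) (regE 8) 9) <| .seq (okE 10) <|
  emitLoop (constE k) (fun I => digE (regE 9) (subE (constE (k - 1)) I)) 11

def verifierCost (k n : ℕ) : ℕ :=
  (n ^ (k - k / 2) + 1) * (7 * wid k n + 18) + numCost (wid k n) + k / 2 * n * (k + 2) * 9 +
  n ^ (k / 2) * (numCost (wid k n) + weightCost k + 13) + rightCost k n +
  n ^ (k / 2) * (chainCost k + numCost (wid k n) + 13) + n ^ (k / 2) * (chainCost k + 22) +
  k * (7 * k + 15) + 14 * k + 100

/-- The verifier accepts the message. -/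
def Accepts (k n : ℕ) (M w : List Bool) (c : ℕ → Bool) : Prop :=
  head k n w < n ^ (k - k / 2) ∧ tail k n M (head k n w) < n ^ (k / 2) ∧ bad k n M w = 0 ∧
    left k n w c = right k n M (head k n w) c

theorem ok_iff (x A T B s l r : ℕ) :
    0 < (if x < A then 1 else 0) * (if T < B then 1 else 0) * ((if s < 1 then 1 else 0) *
      ((1 - if l < r then 1 else 0) * (1 - if r < l then 1 else 0))) ↔
      x < A ∧ T < B ∧ s = 0 ∧ l = r := by
  split_ifs <;> simp <;> omega

open Classical in
theorem verifier_haltsIn (hE : ∀ e ≤ (k + 10) ^ 2, (E.size + 2) ^ e < 2 ^ L) :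
    HaltsIn ((verifierCode k).program 10) E ((verifierCost k E.size + 1) * unit L)
      (if Accepts k E.size E.input E.message E.coins then
        some (tup E.size k (head k E.size E.message * E.size ^ (k / 2) +
          tail k E.size E.input (head k E.size E.message)))
      else none) := by
  set n := E.size with hn
  have hk := Nat.div_le_self k 2
  have hbig : 1024 < 2 ^ L := lt_of_le_of_lt (pb_two_pow n 10) (hE 10 (le_sq_of_le (by omega)))
  have hs₀ : Setup E L ⟨1, E.start.mem⟩ k n :=
    ⟨.reg (by simp) (by simp [Env.start, hn]) ((pb_self n).trans_lt (hE 1 (le_sq_of_le (by omega)))), hE⟩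
  have hpow := fun i (hi : i ≤ k) => hs₀.lt (pb_pow n i) (le_sq_of_le (by omega))
  have hcon := fun c (hc : c ≤ k + 2) => hs₀.const_lt (c := c) (le_sq_of_le (by omega))
  -- `m₁`, …, `m₁₂` are the memories after the successive parts of `verifierCode`. Registers `4` to
  -- `10` receive the head, the claimed and the true value of the form, `bad`, the tail, the code of
  -- the answer, and the verdict.
  obtain ⟨m₁, r₁, l₁, g₁, e₁⟩ := assign (hs₀.reg.pow (Has.const (hcon (k - k / 2) (by omega)))
    fun i hi => hpow i (by omega)) (by omega) 0 []
  have hs₁ := hs₀.lift l₁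
  obtain ⟨m₂, r₂, l₂, g₂, e₂⟩ := assign (hs₁.reg.pow (Has.const (hcon (k / 2) (by omega)))
    fun i hi => hpow i (by omega)) (by omega) 0 []
  have hA2 : 2 * n ^ (k - k / 2) + 2 ≤ (n + 2) ^ (1 + (k - k / 2) + 1 + 1) :=
    pb_add (pb_mul (by rw [pow_one]; omega) (pb_pow n _)) (by rw [pow_one]; omega)
  obtain ⟨m₃, r₃, l₃, g₃, e₃⟩ := assign ((g₁.lift l₂).size (hs₀.lt hA2 (le_sq_of_le (by omega))))
    (by omega) 0 []
  have hs₃ : Setup3 E L ⟨4, m₃⟩ k n :=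
    ⟨(hs₁.lift l₂).lift l₃, (g₁.lift l₂).lift l₃, g₂.lift l₃, g₃⟩
  obtain ⟨m₄, r₄, l₄, g₄, e₄⟩ := assign (has_num hs₃.toSetup hs₃.reg3 (Has.const (v := 0) (by omega))
    (by rw [zero_add]; exact hs₀.lt (pb_wid k n) (le_sq_of_le (by omega)))
    (hs₀.lt (pb_two_pow_wid k n) (le_sq_of_le (by omega)))) (by omega) 0 []
  have hs₄ := hs₃.lift l₄
  have hidx := idx_add_lt hs₀ (Nat.mul_le_mul_right n hk)
  have hcoins : 2 * (k / 2 * n * (k + 2)) + 1 < 2 ^ L := by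
    refine hs₀.lt (pb_add (f := 0) (pb_mul (e := 1) (by rw [pow_one]; omega) (pb_mul (pb_mul
      ((pb_const n _).trans (Nat.pow_le_pow_right (by omega) hk)) (pb_self n))
      (pb_const n (k + 2)))) (by simp)) (le_sq_of_le (by omega))
  have hmul : k / 2 * n < 2 ^ L := by nlinarith
  obtain ⟨m₅, r₅, a₅, c₅⟩ := runs_coinLoop (m := m₄) (l := []) (d := 5)
    (((Has.const (hcon (k / 2) (by omega))).mul hs₄.reg hmul).mul (Has.const (hcon (k + 2) le_rfl))
      (by omega)) (Γ := ⟨5, m₄⟩) le_rfl (by omega) hcoins (Agree.refl _ _)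
  -- The coin loop overwrites the table, so earlier facts cannot be lifted; the contents of
  -- registers `0` to `4` are carried over one by one.
  have b : ∀ r < 5, ∀ v, m₄ (2 * r) = v → v < 2 ^ L → Has E L ⟨5, m₅⟩ (regE r) v 1 1 :=
    fun r hr v hv hvL => .reg hr (by simp only; rw [a₅ r hr, hv]) hvL
  have a₁ : Agree 1 E.start.mem m₁ := l₁.2
  have a₂ : Agree 2 m₁ m₂ := l₂.2
  have a₃ : Agree 3 m₂ m₃ := l₃.2
  have a₄ : Agree 4 m₃ m₄ := l₄.2
  have f₅ : Setup3 E L ⟨5, m₅⟩ k n := by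
    refine ⟨⟨b 0 (by omega) _ ?_ hs₄.reg.1, hE⟩, b 1 (by omega) _ ?_ hs₄.reg1.1,
      b 2 (by omega) _ ?_ hs₄.reg2.1, b 3 (by omega) _ ?_ hs₄.reg3.1⟩
    · rw [a₄.reg (by omega), a₃.reg (by omega), a₂.reg (by omega), a₁.reg (by omega)]
      simp [Env.start, hn]
    · exact (a₄.reg (by omega)).trans <| (a₃.reg (by omega)).trans <| (a₂.reg (by omega)).trans e₁
    · exact (a₄.reg (by omega)).trans <| (a₃.reg (by omega)).trans e₂
    · exact (a₄.reg (by omega)).trans e₃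
  have h₅ : Has E L ⟨5, m₅⟩ (regE 4) (head k n E.message) 1 1 := b 4 (by omega) _ e₄ g₄.1
  have k₅ : Coins E ⟨5, m₅⟩ (k / 2 * n * (k + 2)) := c₅
  obtain ⟨m₆, r₆, l₆, g₆, -⟩ := assign (has_left f₅ k₅) (by omega) (k / 2 * n * (k + 2)) []
  have f₆ := f₅.lift l₆
  obtain ⟨m₇, r₇, l₇, g₇, -⟩ := assign (has_right f₆ (k₅.lift l₆) (h₅.lift l₆)) (by omega)
    (k / 2 * n * (k + 2)) []
  have f₇ := f₆.lift l₇
  obtain ⟨m₈, r₈, l₈, g₈, -⟩ := assign (has_bad f₇) (by omega) (k / 2 * n * (k + 2)) []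
  have f₈ := f₇.lift l₈
  have h₈ := ((h₅.lift l₆).lift l₇).lift l₈
  obtain ⟨m₉, r₉, l₉, g₉, -⟩ := assign (has_tail f₈ h₈) (by omega) (k / 2 * n * (k + 2)) []
  have f₉ := f₈.lift l₉
  have h₉ := h₈.lift l₉
  have htail : tail k n E.input (head k n E.message) ≤ n ^ (k / 2) :=
    (firstOne_spec _ fun T _ => chain_le_one (rel_le_one n E.input) _ _).1
  have hcode := hs₀.lt (pb_code k n E.message htail) (le_sq_of_le (by omega))
  obtain ⟨m₁₀, r₁₀, l₁₀, g₁₀, -⟩ := assign ((h₉.mul f₉.reg2 (by omega)).add g₉ hcode) (by omega)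
    (k / 2 * n * (k + 2)) []
  have f₁₀ := f₉.lift l₁₀
  have hL := hs₀.one_le
  have one : Has E L ⟨10, m₁₀⟩ (constE 1) 1 1 1 := Has.const (by omega)
  have u₆ := (((g₆.lift l₇).lift l₈).lift l₉).lift l₁₀
  have u₇ := ((g₇.lift l₈).lift l₉).lift l₁₀
  have hok := has_mul_one hL (has_mul_one hL ((h₉.lift l₁₀).lt f₁₀.reg1 hL)
    ((g₉.lift l₁₀).lt f₁₀.reg2 hL) (ite_le_one _) (ite_le_one _))
    (has_mul_one hL (((g₈.lift l₉).lift l₁₀).lt one hL)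
      (has_mul_one hL (one.sub (u₆.lt u₇ hL)) (one.sub (u₇.lt u₆ hL)) (Nat.sub_le _ _)
        (Nat.sub_le _ _)) (ite_le_one _) (Nat.mul_le_mul (Nat.sub_le 1 _) (Nat.sub_le 1 _)))
    (Nat.mul_le_mul (ite_le_one _) (ite_le_one _))
    (Nat.mul_le_mul (ite_le_one _) (Nat.mul_le_mul (Nat.sub_le 1 _) (Nat.sub_le 1 _)))
  obtain ⟨m₁₁, r₁₁, l₁₁, g₁₁, e₁₁⟩ := assign hok (by omega) (k / 2 * n * (k + 2)) []
  have f₁₁ := f₁₀.lift l₁₁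
  obtain ⟨m₁₂, r₁₂, a₁₂⟩ := runs_emitLoop (fl := k / 2 * n * (k + 2)) (l := []) (d := 11)
    (e := fun I => digE (regE 9) (subE (constE (k - 1)) I)) (Nb := 7 * k + 11) (hb := 20)
    (Γ := ⟨11, m₁₁⟩) (Has.const (hcon k (by omega)))
    (fun i hi Γ' I hΓ hI => (has_dig (f₁₁.toSetup.lift hΓ) ((g₁₀.lift l₁₁).lift hΓ)
      ((Has.const (hcon (k - 1) (by omega))).sub hI) (by omega)).mono (by omega) (by omega))
    le_rfl (by omega) (Agree.refl _ _)
  have hrun := r₁.seq <| r₂.seq <| r₃.seq <| r₄.seq <| r₅.seq <| r₆.seq <| r₇.seq <| r₈.seq <|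
    r₉.seq <| r₁₀.seq <| r₁₁.seq r₁₂
  have hval : m₁₂ (2 * 10) = _ := (a₁₂.reg (by omega)).trans e₁₁
  have := Runs.haltsIn (ok := 10) (hrun.mono (N' := verifierCost k n) ?_) (by omega)
    (by rw [hval]; exact g₁₁.1)
  · rw [hval] at this
    have hlist : (List.range k).map (fun i => dig n (head k n E.message * n ^ (k / 2) +
        tail k n E.input (head k n E.message)) (k - 1 - i)) = tup n k (head k n E.message *
        n ^ (k / 2) + tail k n E.input (head k n E.message)) := rfl
    have hiff := ok_iff (head k n E.message) (n ^ (k - k / 2)) (tail k n E.input (head k n E.message))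
      (n ^ (k / 2)) (bad k n E.input E.message) (left k n E.message E.coins)
      (right k n E.input (head k n E.message) E.coins)
    rw [List.nil_append, hlist] at this
    simp only [hiff] at this
    refine (show HaltsIn ((verifierCode k).program 10) E _ _ from this).congr_result ?_
    unfold Accepts
    congr
  · unfold verifierCost
    rw [show (n ^ (k - k / 2)).size = wid k n from rfl]
    have h₁ := Nat.sub_le k (k / 2)
    linarith

end CliqueCode

/-! ### The prover -/

namespace CliqueCode

open RAM

variable {E : Env} {L : ℕ} {Γ Γ' : Ctx} {k n : ℕ}

/-- The code of the first solution, and `n ^ k` if there is no solution. -/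
def firstCode (k n : ℕ) (M : List Bool) : ℕ := firstOne (fun Z => chain n (rel n M) Z k) (n ^ k)

theorem firstCode_le (k n : ℕ) (M : List Bool) : firstCode k n M ≤ n ^ k :=
  (firstOne_spec _ fun _ _ => chain_le_one (rel_le_one n M) _ _).1

/-- The first part of the first solution. -/
def firstHead (k n : ℕ) (M : List Bool) : ℕ := firstCode k n M / n ^ (k / 2)

theorem firstHead_le (k n : ℕ) (M : List Bool) : firstHead k n M ≤ n ^ (k - k / 2) := by
  refine Nat.div_le_of_le_mul ?_
  rw [← pow_add, Nat.add_sub_cancel' (Nat.div_le_self k 2)]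
  exact firstCode_le k n M

/-- The value in the table of the honest message. -/
def extensions (k n : ℕ) (M : List Bool) (T : ℕ) : ℕ :=
  count n (rel n M) (k - k / 2) (k / 2) (firstHead k n M) T

def extensionsE (k : ℕ) (T : Ex) : Ex := sumE (regE 5) fun X =>
  mulE (chainE X (k - k / 2)) (prodE (constE (k / 2)) fun J => commonE (k - k / 2) X (digE T J))

def extensionsCost (k A : ℕ) : ℕ :=
  5 + A * (chainCost k + k * (commonCost k (7 * k + 9) + 6) + 12)

theorem extensions_le (k n : ℕ) (M : List Bool) (T : ℕ) : extensions k n M T ≤ n ^ (k - k / 2) :=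
  (count_le (rel_le_one n M) _ _ _ _).trans (firstHead_le k n M)

theorem has_extensions (hs : Setup E L Γ k n) {T : Ex} {t : ℕ}
    (h5 : Has E L Γ (regE 5) (firstHead k n E.input) 1 1) (hT : Has E L Γ T t 1 1) :
    Has E L Γ (extensionsE k T) (extensions k n E.input t)
      (extensionsCost k (n ^ (k - k / 2))) 156 := by
  have hk := Nat.div_le_self k 2
  have h1 := hs.const_lt (c := 1) (le_sq_of_le (by omega))
  have hprod : ∀ X i, ∏ j ∈ Finset.range i, common n (rel n E.input) (k - k / 2) X (dig n t j) ≤ 1 :=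
    fun X i => prod_le_one_of fun j _ => common_le_one (rel_le_one n E.input) _ X _
  refine (h5.sum (Nb := chainCost k + k * (commonCost k (7 * k + 9) + 6) + 6) (hb := 146)
    (hs.lt ((extensions_le k n E.input t).trans (pb_pow n _)) (le_sq_of_le (by omega)))
    fun X hX Γ₁ I hΓ₁ hI => ?_).mono ?_ (by omega)
  · have hs₁ := hs.lift hΓ₁
    refine ((has_chain hs₁ hI (by omega)).mul (((Has.const (hs.const_lt
      (le_sq_of_le (by omega)))).prod (Nb := commonCost k (7 * k + 9)) (hb := 62)
      (fun i _ => (hprod X i).trans_lt h1) fun j hj Γ₂ J hΓ₂ hJ => ?_).mono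
      (N' := 5 + k * (commonCost k (7 * k + 9) + 6)) ?_ le_rfl)
      ((Nat.mul_le_mul (chain_le_one (rel_le_one n E.input) X _) (hprod X _)).trans_lt h1)).mono
      (by omega) (by omega)
    · have hs₂ := hs₁.lift hΓ₂
      exact (has_common hs₂ (hI.lift hΓ₂) (has_dig hs₂ (hT.lift (Ctx.le_trans hΓ₁ hΓ₂)) hJ
        (by omega)) (dig_lt' t j) (by omega)).mono (by unfold commonCost; apply le_of_eq; ring)
        (by omega)
    · have := Nat.mul_le_mul_right (commonCost k (7 * k + 9) + 6) hk
      linarith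
  · have := Nat.mul_le_mul_right (chainCost k + k * (commonCost k (7 * k + 9) + 6) + 12)
      (firstHead_le k n E.input)
    unfold extensionsCost
    linarith

/-- The numbers in the honest message. -/
def entry (k n : ℕ) (M : List Bool) (q : ℕ) : ℕ :=
  (if q < 1 then 1 else 0) * firstHead k n M + (if 0 < q then 1 else 0) * extensions k n M (q - 1)

def entryE (k : ℕ) (q : Ex) : Ex := addE (mulE (ltE q (constE 1)) (regE 5))
  (mulE (ltE (constE 0) q) (letE (subE q (constE 1)) (extensionsE k)))

/-- Both alternatives are evaluated and weighted by indicators. Slot `0` is the head, so slot `q`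
holds the count for the tail `q - 1`. -/
theorem has_entry (hs : Setup E L Γ k n) {Q : Ex} {q : ℕ}
    (h5 : Has E L Γ (regE 5) (firstHead k n E.input) 1 1) (hQ : Has E L Γ Q q 1 1) :
    Has E L Γ (entryE k Q) (entry k n E.input q) (extensionsCost k (n ^ (k - k / 2)) + 18) 177 := by
  have hk := Nat.div_le_self k 2
  have hL := hs.one_le
  have one : Has E L Γ (constE 1) 1 1 1 := Has.const (hs.const_lt (le_sq_of_le (by omega)))
  have hx : ∀ q, (if q < 1 then 1 else 0) * firstHead k n E.input ≤ (n + 2) ^ (0 + (k - k / 2)) :=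
    fun q => pb_mul (ite_le_one _) ((firstHead_le k n E.input).trans (pb_pow n _))
  have hy : ∀ q T, (if 0 < q then 1 else 0) * extensions k n E.input T ≤
      (n + 2) ^ (0 + (k - k / 2)) :=
    fun q T => pb_mul (ite_le_one _) ((extensions_le k n E.input T).trans (pb_pow n _))
  exact (((hQ.lt one hL).mul h5 (hs.lt (hx q) (le_sq_of_le (by omega)))).add
    (((Has.const (v := 0) (by positivity)).lt hQ hL).mul ((hQ.sub one).letE fun Γ₁ T hΓ hT =>
      has_extensions (hs.lift hΓ) (h5.lift hΓ) hT) (hs.lt (hy q _) (le_sq_of_le (by omega))))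
    (hs.lt (pb_add (hx q) (hy q _)) (le_sq_of_le (by omega)))).mono (by omega) (by omega)

/-- The bits of the honest message. -/
def messageBit (k n : ℕ) (M : List Bool) (t : ℕ) : ℕ :=
  entry k n M (t / wid k n) / 2 ^ (t % wid k n) % 2

def messageBitE (k : ℕ) (t : Ex) : Ex :=
  letE (divE t (regE 3)) fun q => letE (modE t (regE 3)) fun i =>
    modE (divE (entryE k q) (powE (constE 2) i)) (constE 2)

/-- Every bit recomputes the whole number it belongs to; this wastes only a factor `wid k n`, which
is logarithmic. -/
theorem has_messageBit (hs : Setup3 E L Γ k n) {I : Ex} {t N : ℕ}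
    (h5 : Has E L Γ (regE 5) (firstHead k n E.input) 1 1) (ht : t < N * wid k n)
    (hI : Has E L Γ I t 1 1) : Has E L Γ (messageBitE k I) (messageBit k n E.input t)
      (extensionsCost k (n ^ (k - k / 2)) + 7 * wid k n + 34) 205 := by
  have hWpos : 0 < wid k n := Nat.pos_of_ne_zero fun h => by simp [h] at ht
  have hi : t % wid k n < wid k n := Nat.mod_lt _ hWpos
  have h2 := hs.const_lt (c := 2) (le_sq_of_le (by omega))
  refine ((hI.div hs.reg3).letE (N' := extensionsCost k (n ^ (k - k / 2)) + 7 * wid k n + 30)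
    (h' := 199) fun Γ₁ Q hΓ₁ hQ => (((hI.lift hΓ₁).mod (hs.reg3.lift hΓ₁)).letE
      (N' := extensionsCost k (n ^ (k - k / 2)) + 7 * wid k n + 26) (h' := 193)
      fun Γ₂ J hΓ₂ hJ => ?_).mono (by omega) (by omega)).mono (by omega) (by omega)
  have hΓ := Ctx.le_trans hΓ₁ hΓ₂
  refine (((has_entry (hs.toSetup.lift hΓ) (h5.lift hΓ) (hQ.lift hΓ₂)).div
    ((Has.const h2).pow hJ fun j hj => ?_)).mod (Has.const h2)).mono (by omega) (by omega)
  exact hs.lt ((Nat.pow_le_pow_right two_pos (hj.trans hi.le)).trans (pb_two_pow_wid k n))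
    (le_sq_of_le (by omega))

/-- The prover. -/
def proverCode (k : ℕ) : Code :=
  .seq (powE (regE 0) (constE (k - k / 2)) 1) <| .seq (powE (regE 0) (constE (k / 2)) 2) <|
  .seq (sizeE (regE 1) 3) <| .seq (firstE (powE (regE 0) (constE k)) (fun Z => chainE Z k) 4) <|
  .seq (divE (regE 4) (regE 2) 5) <| .seq (constE 1 6) <|
  emitLoop (mulE (addE (regE 2) (constE 1)) (regE 3)) (messageBitE k) 7

/-- Two summands matter: the search for the first clique among `n ^ k` codes, and about `n ^ (k / 2)
* wid k n` bits at about `n ^ (k - k / 2)` units each. -/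
def proverCost (k n : ℕ) : ℕ :=
  (n ^ (k - k / 2) + 1) * (7 * wid k n + 18) + n ^ k * (chainCost k + 16) +
  (n ^ (k / 2) + 1) * wid k n * (extensionsCost k (n ^ (k - k / 2)) + 7 * wid k n + 38) +
  21 * k + 100

/-- The output of the prover. -/
def message (k n : ℕ) (M : List Bool) : List ℕ :=
  (List.range ((n ^ (k / 2) + 1) * wid k n)).map (messageBit k n M)

theorem prover_haltsIn (hE : ∀ e ≤ (k + 10) ^ 2, (E.size + 2) ^ e < 2 ^ L) :
    HaltsIn ((proverCode k).program 6) E ((proverCost k E.size + 1) * unit L)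
      (some (message k E.size E.input)) := by
  set n := E.size with hn
  have hk := Nat.div_le_self k 2
  have hbig : 1024 < 2 ^ L := lt_of_le_of_lt (pb_two_pow n 10) (hE 10 (le_sq_of_le (by omega)))
  have hs₀ : Setup E L ⟨1, E.start.mem⟩ k n :=
    ⟨.reg (by simp) (by simp [Env.start, hn]) ((pb_self n).trans_lt (hE 1 (le_sq_of_le (by omega)))), hE⟩
  have hL := hs₀.one_le
  have hpow := fun i (hi : i ≤ k) => hs₀.lt (pb_pow n i) (le_sq_of_le (by omega))
  have hcon := fun c (hc : c ≤ k + 2) => hs₀.const_lt (c := c) (le_sq_of_le (by omega))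
  obtain ⟨m₁, r₁, l₁, g₁, e₁⟩ := assign (hs₀.reg.pow (Has.const (hcon (k - k / 2) (by omega)))
    fun i hi => hpow i (by omega)) (by omega) 0 []
  have hs₁ := hs₀.lift l₁
  obtain ⟨m₂, r₂, l₂, g₂, e₂⟩ := assign (hs₁.reg.pow (Has.const (hcon (k / 2) (by omega)))
    fun i hi => hpow i (by omega)) (by omega) 0 []
  have hA2 : 2 * n ^ (k - k / 2) + 2 ≤ (n + 2) ^ (1 + (k - k / 2) + 1 + 1) :=
    pb_add (pb_mul (by rw [pow_one]; omega) (pb_pow n _)) (by rw [pow_one]; omega)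
  obtain ⟨m₃, r₃, l₃, g₃, e₃⟩ := assign ((g₁.lift l₂).size (hs₀.lt hA2 (le_sq_of_le (by omega))))
    (by omega) 0 []
  have hs₃ : Setup3 E L ⟨4, m₃⟩ k n :=
    ⟨(hs₁.lift l₂).lift l₃, (g₁.lift l₂).lift l₃, g₂.lift l₃, g₃⟩
  obtain ⟨m₄, r₄, l₄, g₄, -⟩ := assign ((hs₃.reg.pow (Has.const (hcon k (by omega)))
    hpow).first (Nb := chainCost k) (hb := 72) hL
    (fun Z _ => chain_le_one (rel_le_one n E.input) _ _)
    fun Z _ Γ₁ I hΓ hI => has_chain (hs₃.toSetup.lift hΓ) hI le_rfl) (by omega) 0 []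
  have hs₄ := hs₃.lift l₄
  obtain ⟨m₅, r₅, l₅, g₅, -⟩ := assign (g₄.div hs₄.reg2) (by omega) 0 []
  obtain ⟨m₆, r₆, l₆, g₆, e₆⟩ := assign (Has.const (E := E) (L := L) (Γ := ⟨6, m₅⟩) (v := 1)
    (by omega)) (by omega) 0 []
  have hs₆ := (hs₄.lift l₅).lift l₆
  have h₅ : Has E L ⟨7, m₆⟩ (regE 5) (firstHead k n E.input) 1 1 := g₅.lift l₆
  have hW := pb_wid k n
  have hB : n ^ (k / 2) + 1 ≤ (n + 2) ^ (k / 2 + 0 + 1) := pb_add (pb_pow n _) (by rw [pow_zero])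
  obtain ⟨m₇, r₇, a₇⟩ := runs_emitLoop (fl := 0) (l := []) (d := 7) (f := messageBit k n E.input)
    (Nb := extensionsCost k (n ^ (k - k / 2)) + 7 * wid k n + 34) (hb := 205) (m := m₆)
    (Γ := ⟨7, m₆⟩) ((hs₆.reg2.add (Has.const (v := 1) (by omega)) (hs₀.lt hB
      (le_sq_of_le (by omega)))).mul hs₆.reg3 (hs₀.lt (pb_mul hB hW) (le_sq_of_le (by omega))))
    (e := messageBitE k) (fun t ht Γ₁ I hΓ₁ hI => has_messageBit (hs₆.lift hΓ₁) (h₅.lift hΓ₁) ht hI)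
    le_rfl (by omega) (Agree.refl _ _)
  have hrun := r₁.seq <| r₂.seq <| r₃.seq <| r₄.seq <| r₅.seq <| r₆.seq r₇
  have hval : m₇ (2 * 6) = 1 := (a₇.reg (by omega)).trans e₆
  have := Runs.haltsIn (ok := 6) (hrun.mono (N' := proverCost k n) ?_) (by omega)
    (by rw [hval]; omega)
  · rw [hval, if_pos one_pos] at this
    exact this
  · unfold proverCost
    rw [show (n ^ (k - k / 2)).size = wid k n from rfl]
    have h₁ := Nat.sub_le k (k / 2)
    linarith

end CliqueCode

/-! ### Correctness of the protocol -/

namespace CliqueCode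

open RAM

variable {k n : ℕ}

theorem firstOne_le {f : ℕ → ℕ} {N i : ℕ} (hf : ∀ i < N, f i ≤ 1) (hi : f i = 1) :
    firstOne f N ≤ i := by
  by_contra! h
  have := (firstOne_spec N hf).2.1 i h
  omega

theorem half_add (k : ℕ) : k / 2 + (k - k / 2) = k := by omega

theorem chain_code {r : ℕ → ℕ → ℕ} (hn : 0 < n) {X T : ℕ} (hT : T < n ^ (k / 2)) :
    chain n r (X * n ^ (k / 2) + T) k = chain n r T (k / 2) * (chain n r X (k - k / 2) *
      ∏ j ∈ Finset.range (k / 2), common n r (k - k / 2) X (dig n T j)) := by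
  rw [← chain_split hn hT, half_add]

theorem code_lt {X T : ℕ} (hX : X < n ^ (k - k / 2)) (hT : T < n ^ (k / 2)) :
    X * n ^ (k / 2) + T < n ^ k := by
  conv_rhs => rw [← half_add k, add_comm, pow_add]
  exact idx_lt hX hT

theorem chain_firstCode {M : List Bool} (h : firstCode k n M < n ^ k) :
    chain n (rel n M) (firstCode k n M) k = 1 :=
  (firstOne_spec (f := fun Z => chain n (rel n M) Z k) (n ^ k)
    fun _ _ => chain_le_one (rel_le_one n M) _ _).2.2 h

theorem firstCode_le_of_chain {M : List Bool} {Z : ℕ} (h : chain n (rel n M) Z k = 1) :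
    firstCode k n M ≤ Z :=
  firstOne_le (fun _ _ => chain_le_one (rel_le_one n M) _ _) h

theorem chain_eq_zero {M : List Bool} {Z : ℕ} (h : Z < firstCode k n M) :
    chain n (rel n M) Z k = 0 :=
  (firstOne_spec (f := fun Z => chain n (rel n M) Z k) (n ^ k)
    fun _ _ => chain_le_one (rel_le_one n M) _ _).2.1 Z h

theorem chain_tail {M : List Bool} {x : ℕ} (h : tail k n M x < n ^ (k / 2)) :
    chain n (rel n M) (x * n ^ (k / 2) + tail k n M x) k = 1 :=
  (firstOne_spec (f := fun T => chain n (rel n M) (x * n ^ (k / 2) + T) k) (n ^ (k / 2))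
    fun _ _ => chain_le_one (rel_le_one n M) _ _).2.2 h

theorem tail_le_of_chain {M : List Bool} {x T : ℕ}
    (h : chain n (rel n M) (x * n ^ (k / 2) + T) k = 1) : tail k n M x ≤ T :=
  firstOne_le (f := fun T => chain n (rel n M) (x * n ^ (k / 2) + T) k)
    (fun _ _ => chain_le_one (rel_le_one n M) _ _) h

/-- What the verifier computes from the graph is the random form with the true counts as
coefficients. -/
theorem right_eq (hn : 0 < n) (M : List Bool) (x : ℕ) (c : ℕ → Bool) : right k n M x c =
    ∑ T ∈ Finset.range (n ^ (k / 2)), count n (rel n M) (k - k / 2) (k / 2) x T *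
      weight k n c T :=
  (sum_count hn (fun j v => coinVal (k + 2) c (j * n + v)) _ _ _).symm

/-! The honest prover -/

/-- The message of the honest prover. -/
def honest (k n : ℕ) (M : List Bool) : List Bool := (message k n M).map fun v => decide (v ≠ 0)

theorem honest_getD (M : List Bool) {t : ℕ} (ht : t < (n ^ (k / 2) + 1) * wid k n) :
    ((honest k n M).getD t false).toNat = messageBit k n M t := by
  have h : messageBit k n M t < 2 := Nat.mod_lt _ two_pos
  rw [honest, message, List.map_map, List.getD_eq_getElem _ _ (by simpa using ht)]
  simp only [List.getElem_map, List.getElem_range, Function.comp]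
  rcases Nat.eq_zero_or_pos (messageBit k n M t) with h0 | h0
  · simp [h0]
  · rw [show messageBit k n M t = 1 by omega]
    rfl

/-- Nothing is lost by truncation: heads and counts are at most `n ^ (k - k / 2)`, whose bit length
is `wid k n`. -/
theorem num_honest (M : List Bool) {q : ℕ} (hq : q < n ^ (k / 2) + 1) :
    num (honest k n M) (wid k n) (q * wid k n) = entry k n M q := by
  refine bitsVal_testBit ?_ fun l hl => ?_
  · refine lt_of_le_of_lt ?_ (Nat.lt_size_self (n ^ (k - k / 2)))
    have h1 := firstHead_le k n M
    have h2 := extensions_le k n M (q - 1)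
    unfold entry
    split_ifs <;> omega
  · rw [honest_getD M (idx_lt hq hl), messageBit, idx_div hl, idx_mod hl]

theorem head_honest (M : List Bool) : head k n (honest k n M) = firstHead k n M := by
  have h := num_honest (k := k) (n := n) M (q := 0) (by omega)
  rw [zero_mul] at h
  rw [head, h, entry]
  simp

theorem table_honest (M : List Bool) {T : ℕ} (hT : T < n ^ (k / 2)) :
    table k n (honest k n M) T = extensions k n M T := by
  have h := num_honest (k := k) (n := n) M (q := T + 1) (by omega)
  rw [table, show wid k n + T * wid k n = (T + 1) * wid k n by ring, h, entry]
  simp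

/-- A smaller tail with the same head would give a clique before the first one. -/
theorem tail_firstHead {M : List Bool} (hn : 0 < n) (h : firstCode k n M < n ^ k) :
    tail k n M (firstHead k n M) = firstCode k n M % n ^ (k / 2) := by
  have hB : 0 < n ^ (k / 2) := by positivity
  have hlt := Nat.mod_lt (firstCode k n M) hB
  have hdm : firstHead k n M * n ^ (k / 2) + firstCode k n M % n ^ (k / 2) = firstCode k n M :=
    Nat.div_add_mod' _ _
  have h1 : tail k n M (firstHead k n M) ≤ firstCode k n M % n ^ (k / 2) :=
    tail_le_of_chain (by rw [hdm]; exact chain_firstCode h)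
  have h2 := firstCode_le_of_chain (chain_tail (h1.trans_lt hlt))
  omega

theorem accepts_honest {M : List Bool} (hn : 0 < n) (h : firstCode k n M < n ^ k) (c : ℕ → Bool) :
    Accepts k n M (honest k n M) c := by
  have hB : 0 < n ^ (k / 2) := by positivity
  have hlt := Nat.mod_lt (firstCode k n M) hB
  rw [Accepts, head_honest, tail_firstHead hn h]
  refine ⟨?_, hlt, ?_, ?_⟩
  · refine Nat.div_lt_of_lt_mul ?_
    rwa [← pow_add, half_add]
  -- Each term of the count, multiplied by the indicator of `T`, indicates a clique whose head is
  -- below that of the first clique; there is none.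
  · refine Finset.sum_eq_zero fun T hT => ?_
    have hT := Finset.mem_range.1 hT
    rw [table_honest M hT, extensions, count, Finset.mul_sum]
    refine Finset.sum_eq_zero fun X hX => ?_
    rw [← chain_code hn hT]
    refine chain_eq_zero ?_
    exact (idx_lt (Finset.mem_range.1 hX) hT).trans_le (Nat.div_mul_le_self _ _)
  · rw [right_eq hn]
    exact Finset.sum_congr rfl fun T hT => by
      rw [table_honest M (Finset.mem_range.1 hT), extensions]

/-! Soundness -/

/-- The reason for `k + 2` coins per random number: the form has degree at most `k / 2`. -/
theorem three_mul_half_le (k : ℕ) : 3 * (k / 2) ≤ 2 ^ (k + 2) := by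
  have := (Nat.lt_two_pow_self (n := k))
  rw [pow_add]
  omega

theorem fairCoins_accepts_le {M w : List Bool} (hn : 0 < n)
    (h : head k n w * n ^ (k / 2) + tail k n M (head k n w) ≠ firstCode k n M) :
    fairCoins {c | Accepts k n M w c} ≤ 1 / 3 := by
  have hB : 0 < n ^ (k / 2) := by positivity
  -- The first three checks do not depend on the coins; if one of them fails, acceptance is
  -- impossible.
  by_cases hdet : head k n w < n ^ (k - k / 2) ∧ tail k n M (head k n w) < n ^ (k / 2) ∧
      bad k n M w = 0
  swap
  · rw [show {c | Accepts k n M w c} = ∅ from Set.eq_empty_of_forall_notMem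
      fun c hc => hdet ⟨hc.1, hc.2.1, hc.2.2.1⟩, measure_empty]
    exact zero_le
  obtain ⟨hx, ht, hbad⟩ := hdet
  have hle := firstCode_le_of_chain (chain_tail ht)
  have hfirst := chain_firstCode (hle.trans_lt (code_lt hx ht))
  set Z := firstCode k n M
  have hT := Nat.mod_lt Z hB
  have hdm : Z / n ^ (k / 2) * n ^ (k / 2) + Z % n ^ (k / 2) = Z := Nat.div_add_mod' _ _
  -- If the heads agreed, the search for the tail would have found the first clique itself, contrary
  -- to `h`.
  have hX : Z / n ^ (k / 2) < head k n w := by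
    by_contra! hX
    have h1 : Z / n ^ (k / 2) = head k n w := by
      refine le_antisymm ?_ hX
      rw [← Nat.lt_add_one_iff, Nat.div_lt_iff_lt_mul hB, add_mul]
      omega
    rw [h1] at hdm
    have := tail_le_of_chain (by rw [hdm]; exact hfirst)
    omega
  rw [← hdm, chain_code hn hT] at hfirst
  obtain ⟨h1, h2⟩ := mul_eq_one.1 hfirst
  have h3 := Finset.sum_eq_zero_iff.1 hbad _ (Finset.mem_range.2 hT)
  rw [h1, one_mul] at h3
  -- The head of the first clique is one of those counted at its tail, where `bad = 0` forces the
  -- table entry to be `0`. So the difference of the two forms has a nonzero coefficient.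
  have h4 : 1 ≤ count n (rel n M) (k - k / 2) (k / 2) (head k n w) (Z % n ^ (k / 2)) :=
    h2.symm.le.trans (Finset.single_le_sum (f := fun X => chain n (rel n M) X (k - k / 2) *
      ∏ j ∈ Finset.range (k / 2), common n (rel n M) (k - k / 2) X (dig n (Z % n ^ (k / 2)) j))
      (fun _ _ => Nat.zero_le _) (Finset.mem_range.2 hX))
  refine (measure_mono fun c hc => ?_).trans (fairCoins_form_le hn (three_mul_half_le k)
    (t := fun T => (table k n w T : ℤ) - count n (rel n M) (k - k / 2) (k / 2) (head k n w) T)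
    hT (by simp only [h3]; omega))
  have h5 := hc.2.2.2
  rw [right_eq hn] at h5
  simp only [Set.mem_ofPred_eq, form, sub_mul, Finset.sum_sub_distrib, sub_eq_zero]
  unfold left weight at h5
  exact_mod_cast h5

end CliqueCode

/-! ### The proof system -/

namespace CliqueCode

open RAM

/-- Bit length of the numbers that occur. -/
def bitLen (k n : ℕ) : ℕ := (k + 10) ^ 2 * (n + 2).size

theorem pow_lt_two_pow_bitLen (k n e : ℕ) (he : e ≤ (k + 10) ^ 2) : (n + 2) ^ e < 2 ^ bitLen k n := by
  rw [bitLen, mul_comm, pow_mul]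
  exact (Nat.pow_le_pow_right (by omega) he).trans_lt
    (Nat.pow_lt_pow_left (Nat.lt_size_self _) (by positivity))

def verifierTime (k n : ℕ) : ℕ := (verifierCost k n + 1) * unit (bitLen k n)

def proverTime (k n : ℕ) : ℕ := (proverCost k n + 1) * unit (bitLen k n)

/-- The first solution. -/
noncomputable def canonical (k : ℕ) (G : (kClique k).Inst) : List ℕ :=
  tup G.1 k (firstCode k G.1 ((kClique k).encode G))

theorem mem_solvable_iff {k : ℕ} {G : (kClique k).Inst} :
    G ∈ (kClique k).solvable ↔ firstCode k G.1 ((kClique k).encode G) < G.1 ^ k := by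
  simp only [SearchProblem.solvable, Set.mem_ofPred_eq, sol_iff_exists_tup]
  constructor
  · rintro ⟨y, Z, hZ, hc, -⟩
    exact (firstCode_le_of_chain hc).trans_lt hZ
  · exact fun h => ⟨_, _, h, chain_firstCode h, rfl⟩

theorem isLexFirst_canonical {k : ℕ} {G : (kClique k).Inst} (hG : G ∈ (kClique k).solvable) :
    (kClique k).IsLexFirst G (canonical k G) := by
  rw [mem_solvable_iff] at hG
  refine ⟨(sol_iff_exists_tup _ _).2 ⟨_, hG, chain_firstCode hG, rfl⟩, fun y hy => ?_⟩
  obtain ⟨Z, hZ, hc, rfl⟩ := (sol_iff_exists_tup _ _).1 hy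
  refine tup_lex ?_
  rw [Nat.mod_eq_of_lt hG, Nat.mod_eq_of_lt hZ]
  exact firstCode_le_of_chain hc

theorem isPseudoDetMA {k : ℕ} (hk : 1 ≤ k) :
    (kClique k).IsPseudoDetMA (canonical k) ((verifierCode k).program 10)
      ((proverCode k).program 6) (verifierTime k) (proverTime k) := by
  classical
  have hV : ∀ (G : (kClique k).Inst) (w : List Bool) (r : ℕ → Bool),
      HaltsIn ((verifierCode k).program 10) ((kClique k).verifierEnv G w r) (verifierTime k G.1)
        (if Accepts k G.1 ((kClique k).encode G) w r then
          some (tup G.1 k (head k G.1 w * G.1 ^ (k / 2) +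
            tail k G.1 ((kClique k).encode G) (head k G.1 w))) else none) := fun G w r =>
    (verifier_haltsIn (E := (kClique k).verifierEnv G w r)
      (pow_lt_two_pow_bitLen k G.1)).congr_result (by congr)
  have hpos : ∀ G : (kClique k).Inst, G ∈ (kClique k).solvable → 0 < G.1 := fun G hG =>
    pos_of_lt_pow (by omega) (mem_solvable_iff.1 hG)
  have hP : ∀ (G : (kClique k).Inst) (ρ : ℕ → Bool),
      HaltsIn ((proverCode k).program 6) ((kClique k).proverEnv G ρ) (proverTime k G.1)
        (some (message k G.1 ((kClique k).encode G))) := fun G ρ =>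
    prover_haltsIn (E := (kClique k).proverEnv G ρ) (pow_lt_two_pow_bitLen k G.1)
  refine ⟨fun G hG => (isLexFirst_canonical hG).1, fun G hG => ?_, fun G hG w => ?_,
    fun G hG w => ?_, fun G w r => ⟨_, hV G w r⟩, fun G ρ => ⟨_, hP G ρ⟩⟩
  · have hn := hpos G hG
    have hfirst := mem_solvable_iff.1 hG
    -- Completeness is perfect: the event is everything.
    refine le_trans ?_ (measure_mono (s := Set.univ) fun ρr _ =>
      ⟨_, ⟨_, ⟨_, hP G ρr.1⟩, rfl⟩, _, (hV G _ ρr.2).congr_result ?_⟩)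
    · have : IsProbabilityMeasure fairCoins := by unfold fairCoins; infer_instance
      rw [measure_univ]
      exact ENNReal.div_le_of_le_mul (by norm_num)
    · have hacc := accepts_honest hn hfirst ρr.2
      rw [honest] at hacc
      rw [if_pos hacc]
      have h1 := head_honest (k := k) (n := G.1) ((kClique k).encode G)
      rw [honest] at h1
      rw [h1, tail_firstHead hn hfirst, canonical, firstHead, Nat.div_add_mod']
  · have hn := hpos G hG
    have : IsProbabilityMeasure fairCoins := by unfold fairCoins; infer_instance
    set M := (kClique k).encode G
    set A := {c | Accepts k G.1 M w c}
    -- If the message leads to the first code, the result is canonical or `⊥` for all coins;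
    -- otherwise acceptance has probability at most `1 / 3`.
    by_cases h : head k G.1 w * G.1 ^ (k / 2) + tail k G.1 M (head k G.1 w) = firstCode k G.1 M
    · rw [Set.eq_univ_of_forall (s := {r : ℕ → Bool | _}) fun r => ?_]
      · rw [measure_univ]
        exact ENNReal.div_le_of_le_mul (by norm_num)
      · by_cases hr : Accepts k G.1 M w r
        · refine .inl ⟨_, (hV G w r).congr_result ?_⟩
          rw [if_pos hr, h]
          rfl
        · exact .inr ⟨_, (hV G w r).congr_result (if_neg hr)⟩
    -- Subadditivity is enough here, so the measurability of `A` is not needed.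
    · have h1 : (1 : ENNReal) ≤ fairCoins A + fairCoins Aᶜ := by
        rw [← measure_univ (μ := fairCoins), ← Set.union_compl_self A]
        exact measure_union_le _ _
      have h2 : (1 : ENNReal) ≤ 1 / 3 + fairCoins Aᶜ :=
        h1.trans (add_le_add_left (fairCoins_accepts_le hn h) _)
      refine le_trans ?_ (measure_mono fun r (hr : ¬ Accepts k G.1 M w r) =>
        .inr ⟨_, (hV G w r).congr_result (if_neg hr)⟩)
      have h3 : (1 / 3 : ENNReal) + 2 / 3 = 1 := by
        rw [ENNReal.div_add_div_same, show (1 : ENNReal) + 2 = 3 by norm_num]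
        exact ENNReal.div_self (by norm_num) (by norm_num)
      exact (ENNReal.add_le_add_iff_left (a := 1 / 3) (by norm_num)).1 (h3.le.trans h2)
  -- An accepted answer is a clique, so on unsolvable instances the error probability is zero.
  · rw [Set.eq_empty_of_forall_notMem (s := {r : ℕ → Bool | _}) fun r hr => ?_, measure_empty]
    · exact zero_le
    · refine hr ⟨_, (hV G w r).congr_result (if_neg fun hacc => hG ?_)⟩
      exact mem_solvable_iff.2 ((firstCode_le_of_chain (chain_tail hacc.2.1)).trans_lt
        (code_lt hacc.1 hacc.2.1))

end CliqueCode

/-! ### The running times -/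

namespace CliqueCode

open RAM

/-- `f` grows at most as `n ^ d * log n ^ e`. -/
def Growth (d e : ℕ) (f : ℕ → ℕ) : Prop :=
  (fun n => (f n : ℝ)) =O[atTop] fun n : ℕ => (n : ℝ) ^ d * Real.log n ^ e

theorem eventually_le_log (c : ℝ) : ∀ᶠ n : ℕ in atTop, c ≤ Real.log n :=
  (Real.tendsto_log_atTop.comp tendsto_natCast_atTop_atTop).eventually_ge_atTop c

theorem Growth.mono {d e d' e' : ℕ} {f : ℕ → ℕ} (h : Growth d e f) (hd : d ≤ d') (he : e ≤ e') :
    Growth d' e' f := by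
  refine h.trans (.of_bound 1 ?_)
  filter_upwards [eventually_le_log 1, eventually_ge_atTop 1] with n h1 h2
  have h3 : (1 : ℝ) ≤ n := by exact_mod_cast h2
  rw [one_mul, Real.norm_of_nonneg (by positivity), Real.norm_of_nonneg (by positivity)]
  gcongr

theorem Growth.of_le {d e : ℕ} {f g : ℕ → ℕ} (h : Growth d e f) (hg : ∀ n, g n ≤ f n) :
    Growth d e g := by
  have h1 : (fun n => (g n : ℝ)) =O[atTop] fun n => (f n : ℝ) :=
    Asymptotics.IsBigO.of_bound (1 : ℝ) (Eventually.of_forall fun n : ℕ => by simpa using hg n)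
  exact h1.trans h

theorem Growth.const (c : ℕ) : Growth 0 0 fun _ => c := by
  unfold Growth
  simpa using Asymptotics.isBigO_const_const (c : ℝ) (one_ne_zero (α := ℝ)) (atTop : Filter ℕ)

theorem Growth.pow (d : ℕ) : Growth d 0 fun n => n ^ d := by
  unfold Growth
  simpa using Asymptotics.isBigO_refl (fun n : ℕ => (n : ℝ) ^ d) atTop

theorem Growth.add {d e : ℕ} {f g : ℕ → ℕ} (hf : Growth d e f) (hg : Growth d e g) :
    Growth d e fun n => f n + g n := by
  unfold Growth
  simpa using Asymptotics.IsBigO.add hf hg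

theorem Growth.mul {d e d' e' : ℕ} {f g : ℕ → ℕ} (hf : Growth d e f) (hg : Growth d' e' g) :
    Growth (d + d') (e + e') fun n => f n * g n := by
  refine (Asymptotics.IsBigO.mul hf hg).congr (fun n => ?_) fun n => ?_
  · exact (Nat.cast_mul _ _).symm
  · ring

theorem Growth.add_const {d e : ℕ} {f : ℕ → ℕ} (hf : Growth d e f) (c : ℕ) :
    Growth d e fun n => f n + c := hf.add ((Growth.const c).mono (Nat.zero_le _) (Nat.zero_le _))

theorem Growth.const_mul {d e : ℕ} {f : ℕ → ℕ} (hf : Growth d e f) (c : ℕ) :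
    Growth d e fun n => c * f n := by
  simpa using (Growth.const c).mul hf

/-- One extra factor `log n` eventually exceeds the implied constant; this is how constants
depending on `k` become absolute. -/
theorem Growth.eventually_le {d e : ℕ} {f : ℕ → ℕ} (hf : Growth d e f) :
    ∀ᶠ n : ℕ in atTop, (f n : ℝ) ≤ (n : ℝ) ^ d * Real.log n ^ (e + 1) := by
  obtain ⟨c, hc⟩ := Asymptotics.IsBigO.bound hf
  filter_upwards [hc, eventually_le_log c, eventually_le_log 0] with n h1 h2 h3
  rw [Real.norm_of_nonneg (by positivity), Real.norm_of_nonneg (by positivity)] at h1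
  calc (f n : ℝ) ≤ c * ((n : ℝ) ^ d * Real.log n ^ e) := h1
    _ ≤ Real.log n * ((n : ℝ) ^ d * Real.log n ^ e) := by gcongr
    _ = _ := by ring

theorem growth_size : Growth 0 1 fun n => (n + 2).size := by
  refine .of_bound (2 / Real.log 2 + 1) ?_
  filter_upwards [eventually_ge_atTop 2, eventually_le_log 1] with n hn h1
  have hlog2 : 0 < Real.log 2 := Real.log_pos one_lt_two
  -- For `n ≥ 2`, `n + 2 ≤ n ^ 2`, which replaces `log (n + 2)` by `2 * log n`.
  have h2 : 2 ^ ((n + 2).size - 1) ≤ n ^ 2 := by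
    have h3 : 0 < (n + 2).size := Nat.size_pos.2 (by omega)
    have h4 : 2 ^ ((n + 2).size - 1) ≤ n + 2 := Nat.lt_size.1 (by omega)
    nlinarith
  have h5 : (((n + 2).size - 1 : ℕ) : ℝ) * Real.log 2 ≤ 2 * Real.log n := by
    rw [← Real.log_pow, ← Nat.cast_ofNat (n := 2), ← Real.log_pow]
    refine Real.log_le_log (by positivity) ?_
    exact_mod_cast h2
  have h6 : ((n + 2).size : ℝ) ≤ ((n + 2).size - 1 : ℕ) + 1 := by
    have : (n + 2).size ≤ (n + 2).size - 1 + 1 := by omega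
    exact_mod_cast this
  rw [Real.norm_of_nonneg (by positivity), Real.norm_of_nonneg (by positivity), pow_zero, one_mul,
    pow_one]
  have h7 : (((n + 2).size - 1 : ℕ) : ℝ) ≤ 2 / Real.log 2 * Real.log n := by
    rw [div_mul_eq_mul_div, le_div_iff₀ hlog2]
    exact h5
  linarith

theorem growth_bitLen (k : ℕ) : Growth 0 1 (bitLen k) := growth_size.const_mul _

theorem growth_wid (k : ℕ) : Growth 0 1 (wid k) := (growth_bitLen k).of_le fun n =>
  Nat.size_le.2 ((pb_pow n _).trans_lt (pow_lt_two_pow_bitLen k n _ (le_sq_of_le (by omega))))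

theorem growth_unit (k : ℕ) : Growth 0 2 fun n => unit (bitLen k n) :=
  ((((growth_bitLen k).mul (growth_bitLen k)).add
    (((growth_bitLen k).const_mul 6).mono le_rfl (by omega))).add_const 1)

theorem growth_numCost (k : ℕ) : Growth 0 2 fun n => numCost (wid k n) := by
  have h := growth_wid k
  refine (((h.mul ((h.const_mul 7).add_const 16))).add_const 5).of_le fun n => ?_
  unfold numCost
  omega

/-- The degree comes from `h5`, the cost of `right`: `k - k / 2 + 1 ≤ k / 2 + 2`, with equality for
odd `k`. The other summands have degree at most `k / 2 + 1`. -/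
theorem growth_verifierCost (k : ℕ) : Growth (k / 2 + 2) 2 (verifierCost k) := by
  have hW := growth_wid k
  have hN := growth_numCost k
  have hA := Growth.pow (k - k / 2)
  have hB := Growth.pow (k / 2)
  have h1 := ((hA.add_const 1).mul ((hW.const_mul 7).add_const 18)).mono (d' := k / 2 + 2) (e' := 2)
    (by omega) (by omega)
  have h2 := hN.mono (d' := k / 2 + 2) (e' := 2) (by omega) (by omega)
  have h3 := ((Growth.pow 1).const_mul (k / 2 * (k + 2) * 9)).mono (d' := k / 2 + 2) (e' := 2)
    (by omega) (by omega)
  have h4 := (hB.mul ((hN.add_const (weightCost k)).add_const 13)).mono (d' := k / 2 + 2) (e' := 2)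
    (by omega) (by omega)
  have h5 := (((hA.const_mul 2).add_const 1).mul ((((Growth.pow 1).const_mul
    (k * (commonCost k 1 + coinCost (k + 2) + 13)))).add_const (k * 11 + chainCost k + 12))).mono
    (d' := k / 2 + 2) (e' := 2) (by omega) (by omega)
  have h6 := (hB.mul (hN.add_const (chainCost k + 13))).mono (d' := k / 2 + 2) (e' := 2)
    (by omega) (by omega)
  have h7 := (hB.const_mul (chainCost k + 22)).mono (d' := k / 2 + 2) (e' := 2)
    (by omega) (by omega)
  refine (((((((h1.add h2).add h3).add h4).add h5).add h6).add h7).add_const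
    (k * (7 * k + 15) + 14 * k + 105)).of_le fun n => le_of_eq ?_
  simp only [verifierCost, rightCost, pow_one]
  ring

theorem growth_proverCost (k : ℕ) : Growth k 2 (proverCost k) := by
  have hW := growth_wid k
  have hA := Growth.pow (k - k / 2)
  have hB := Growth.pow (k / 2)
  have h1 := ((hA.add_const 1).mul ((hW.const_mul 7).add_const 18)).mono (d' := k) (e' := 2)
    (by omega) (by omega)
  have h2 := ((Growth.pow k).const_mul (chainCost k + 16)).mono (d' := k) (e' := 2)
    (by omega) (by omega)
  have h3 := (((hB.add_const 1).mul hW).mul ((((hA.const_mul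
    (chainCost k + k * (commonCost k (7 * k + 9) + 6) + 12)).mono le_rfl (e' := 1) (by omega)).add
    ((hW.const_mul 7).mono (Nat.zero_le _) le_rfl)).add_const 43)).mono (d' := k) (e' := 2)
    (by omega) (by omega)
  refine (((h1.add h2).add h3).add_const (21 * k + 100)).of_le fun n => le_of_eq ?_
  simp only [proverCost, extensionsCost]
  ring

theorem growth_verifierTime (k : ℕ) : Growth (k / 2 + 2) 4 (verifierTime k) :=
  ((growth_verifierCost k).add_const 1).mul (growth_unit k)

theorem growth_proverTime (k : ℕ) : Growth k 4 (proverTime k) :=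
  ((growth_proverCost k).add_const 1).mul (growth_unit k)

end CliqueCode

theorem mainTheorem8 :
    ∃ (C : ℝ) (e : ℕ), ∀ k : ℕ, 1 ≤ k →
      ∃ (V P : RAM.Program) (c : (kClique k).Inst → List ℕ) (tV tP : ℕ → ℕ),
        (kClique k).IsPseudoDetMA c V P tV tP ∧
        (∀ G ∈ (kClique k).solvable, (kClique k).IsLexFirst G (c G)) ∧
        (∀ᶠ n : ℕ in atTop,
          (tV n : ℝ) ≤ C * ((n : ℝ) ^ (k / 2 + 2) * (k : ℝ)) * Real.log n ^ e) ∧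
        (∀ᶠ n : ℕ in atTop, (tP n : ℝ) ≤ C * (n : ℝ) ^ k * Real.log n ^ e) := by
  -- Two logarithms come from the instruction counts, two from the cost of an instruction, and the
  -- fifth absorbs the constants. The factor `k ≥ 1` in the verifier's bound only weakens it.
  refine ⟨1, 5, fun k hk => ⟨_, _, CliqueCode.canonical k, CliqueCode.verifierTime k,
    CliqueCode.proverTime k, CliqueCode.isPseudoDetMA hk,
    fun G hG => CliqueCode.isLexFirst_canonical hG, ?_, ?_⟩⟩
  · filter_upwards [(CliqueCode.growth_verifierTime k).eventually_le,
      CliqueCode.eventually_le_log 0] with n h1 h2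
    have h3 : (1 : ℝ) ≤ k := by exact_mod_cast hk
    refine h1.trans ?_
    rw [one_mul]
    gcongr
    exact le_mul_of_one_le_right (by positivity) h3
  · filter_upwards [(CliqueCode.growth_proverTime k).eventually_le] with n h1
    rwa [one_mul]
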